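/- All vector spaces are over $\mathbb{Z}_2$. A persistence module $V$ consists of vector spaces $V_t$, $t\in\mathbb{R}$, and linear maps $\rho^V_{st}\colon V_s\to V_t$ for $s\le t$, with $\rho^V_{tt}=\mathrm{id}$ and $\rho^V_{st}\rho^V_{rs}=\rho^V_{rt}$; a morphism $f\colon V\to U$ is a family of linear maps $f_t\colon V_t\to U_t$ commuting with the structure maps. Two morphisms $f\colon V\to U$ and $f'\colon V'\to U'$ are isomorphic, $f\simeq f'$, if there are isomorphisms of persistence modules $V\cong V'$ and $U\cong U'$ that carry $f$ to $f'$. Direct sums of modules and of morphisms are taken pointwise. For an interval $I\subseteq\mathbb{R}$ let $\kappa_I$ be the interval module of $I$ (equal to $\mathbb{Z}_2$ at each $t\in I$ and to $0$ elsewhere, with identity maps inside $I$), and put $\kappa_b=\kappa_{[0,b)}$ for $b>0$ and $\kappa_\infty=\kappa_{[0,\infty)}$. For $a\ge b>0$ let $\kappa_a\to\kappa_b$ be the morphism that is the identity of $\mathbb{Z}_2$ at every $t\in[0,b)$ and zero at every other $t$, and let $\kappa_\infty\to\kappa_\infty$ be the identity. For a finite metric space $Z$, let $\mathrm{PH}_0(Z)$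 be the persistence module that is zero at $r<0$ and whose value at $r\ge 0$ is the vector space freely generated by the connected components of the graph $\mathrm{VR}_r(Z)$ on $Z$ in which distinct points at distance at most $r$ are adjacent; its structure maps are induced by inclusion of graphs. A map $f_\bullet\colon X\to Z$ with $d_Z(f_\bullet(x),f_\bullet(y))\le d_X(x,y)$ for all $x,y\in X$ (a non-expansive map) induces a morphism $f\colon \mathrm{PH}_0(X)\to \mathrm{PH}_0(Z)$. For a persistence module $U$ and $b>0$ put $\ker_b^+(U)=\ker(\rho^U_{0b})$ and $\ker_b^-(U)=\bigcup_{0\le r<b}\ker(\rho^U_{0r})$. For $f\colon V\to U$ and $a,b>0$ put $$\mathcal{M}^0_f(a,b)=\dim\left(\frac{f_0(\ker_a^+(V))\cap\ker_b^+(U)}{f_0(\ker_a^-(V))\cap\ker_b^+(U)+f_0(\ker_a^+(V))\cap\ker_b^-(U)}\right).$$ **Proposition 4.3.** Let $X$ and $Z$ be non-empty finite metric spaces, let $f_\bullet\colon X\to Z$ be a non-expansive injective map, and let $f\colon V=\mathrm{PH}_0(X)\to U=\mathrm{PH}_0(Z)$ be the induced morphism. Then $U$ has a barcode, that is, there are multiplicities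 $m^U(J)\in\mathbb{Z}_{\ge 0}$, for the bounded intervals $J=[p,q)$ with $p<q$, such that $U\cong\bigoplus_J\kappa_J^{\,m^U(J)}\oplus\kappa_\infty$. For every such $m^U$, write $m^U(b)=m^U([0,b))$. For each $b>0$, only finitely many of the numbers $\mathcal{M}^0_f(a,b)$, $a>0$, are non-zero, the integer $$N_f(b)=m^U(b)-\sum_{a>0}\mathcal{M}^0_f(a,b)$$ is non-negative, and $$f\;\simeq\;\bigg(\bigoplus_{b>0}\bigoplus_{a\ge b}\bigoplus_{s=1}^{\mathcal{M}^0_f(a,b)}(\kappa_a\to\kappa_b)\bigg)\oplus\bigg(\bigoplus_{b>0}\bigoplus_{s=1}^{N_f(b)}(0\to\kappa_b)\bigg)\oplus(\kappa_\infty\to\kappa_\infty).$$ In particular, for no $a>0$ does $f$ have a direct summand isomorphic to $\kappa_a\to 0$. -/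

import Mathlib

/-!
Persistence modules over the field with two elements, ladders, the 0-persistent homology of the
Vietoris-Rips filtration of a metric space, barcodes, and the block function of a morphism.
-/

universe u v w u' v' w'

noncomputable section

/-- A persistence module over `ZMod 2`, indexed by the real line. -/
structure PersistenceModule where
  space : ℝ → Type u
  [addCommGroup : ∀ t, AddCommGroup (space t)]
  [module : ∀ t, Module (ZMod 2) (space t)]
  map : ∀ {s t : ℝ}, s ≤ t → (space s →ₗ[ZMod 2] space t)
  map_self : ∀ (t : ℝ) (x : space t), map (le_refl t) x = x
  map_comp : ∀ {r s t : ℝ} (hrs : r ≤ s) (hst : s ≤ t) (x : space r),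
    map hst (map hrs x) = map (hrs.trans hst) x

attribute [instance] PersistenceModule.addCommGroup PersistenceModule.module

namespace PersistenceModule

/-- A persistence morphism: linear maps that commute with the structure maps. -/
structure Hom (V : PersistenceModule.{u}) (U : PersistenceModule.{v}) where
  app : ∀ t : ℝ, V.space t →ₗ[ZMod 2] U.space t
  naturality : ∀ {s t : ℝ} (h : s ≤ t) (x : V.space s), U.map h (app s x) = app t (V.map h x)

/-- The identity morphism. -/
def Hom.id (V : PersistenceModule.{u}) : Hom V V where
  app _ := LinearMap.id
  naturality _ _ := rfl

/-- The zero morphism. -/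
def Hom.zero (V : PersistenceModule.{u}) (U : PersistenceModule.{v}) : Hom V U where
  app _ := 0
  naturality _ _ := map_zero _

/-- An isomorphism of persistence modules: linear isomorphisms that commute with the structure
maps. -/
structure Iso (V : PersistenceModule.{u}) (U : PersistenceModule.{v}) where
  app : ∀ t : ℝ, V.space t ≃ₗ[ZMod 2] U.space t
  naturality : ∀ {s t : ℝ} (h : s ≤ t) (x : V.space s), U.map h (app s x) = app t (V.map h x)

/-- The zero persistence module. -/
def zero : PersistenceModule.{0} where
  space _ := PUnit
  map _ := 0
  map_self _ _ := rfl
  map_comp _ _ _ := rfl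

/-- The (pointwise) direct sum of a family of persistence modules. -/
def directSum {ι : Type w} (V : ι → PersistenceModule.{u}) : PersistenceModule.{max w u} where
  space t := DirectSum ι fun i => (V i).space t
  map h := DirectSum.lmap fun i => (V i).map h
  map_self t x := DFinsupp.ext fun i => (V i).map_self t (x i)
  map_comp hrs hst x := DFinsupp.ext fun i => (V i).map_comp hrs hst (x i)

/-- The (pointwise) direct sum of two persistence modules. -/
def prod (V : PersistenceModule.{u}) (U : PersistenceModule.{v}) :
    PersistenceModule.{max u v} where
  space t := V.space t × U.space t
  map h := (V.map h).prodMap (U.map h)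
  map_self t x := Prod.ext (V.map_self t x.1) (U.map_self t x.2)
  map_comp hrs hst x := Prod.ext (V.map_comp hrs hst x.1) (U.map_comp hrs hst x.2)

/-- The value at `t` of the interval module of `I`, as a subspace of `ZMod 2`: all of `ZMod 2` if
`t ∈ I`, and zero otherwise. -/
def intervalSpace (I : Set ℝ) (t : ℝ) : Submodule (ZMod 2) (ZMod 2) where
  carrier := {x | t ∉ I → x = 0}
  zero_mem' _ := rfl
  add_mem' hx hy h := by rw [hx h, hy h, add_zero]
  smul_mem' c x hx h := by rw [hx h, smul_zero]

open Classical in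
/-- The linear map between values of two interval modules which is the identity of `ZMod 2` if
both values are `ZMod 2`, and zero otherwise. -/
def intervalSpaceMap (I J : Set ℝ) (s t : ℝ) :
    intervalSpace I s →ₗ[ZMod 2] intervalSpace J t where
  toFun x := ⟨if t ∈ J then x.1 else 0, fun h => if_neg h⟩
  map_add' x y := by
    apply Subtype.ext
    by_cases h : t ∈ J <;> simp [h]
  map_smul' c x := by
    apply Subtype.ext
    by_cases h : t ∈ J <;> simp [h]

theorem intervalSpaceMap_of_mem {I J : Set ℝ} {s t : ℝ} (h : t ∈ J) (x : intervalSpace I s) :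
    (intervalSpaceMap I J s t x).1 = x.1 :=
  if_pos h

theorem intervalSpaceMap_of_notMem {I J : Set ℝ} {s t : ℝ} (h : t ∉ J) (x : intervalSpace I s) :
    (intervalSpaceMap I J s t x).1 = 0 :=
  if_neg h

/-- The interval module of an interval `I` of the real line. -/
def interval (I : Set ℝ) [hI : I.OrdConnected] : PersistenceModule.{0} where
  space t := intervalSpace I t
  map {s t} _ := intervalSpaceMap I I s t
  map_self t x := by
    refine Subtype.ext ?_
    by_cases h : t ∈ I
    · simp [intervalSpaceMap, h]
    · simp [intervalSpaceMap, h, x.2 h]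
  map_comp {r s t} hrs hst x := by
    refine Subtype.ext ?_
    by_cases ht : t ∈ I
    · by_cases hs : s ∈ I
      · simp [intervalSpaceMap, ht, hs]
      · have hr : r ∉ I := fun hr => hs (hI.out hr ht ⟨hrs, hst⟩)
        simp [intervalSpaceMap, x.2 hr]
    · simp [intervalSpaceMap, ht]

/-- The interval module of `[0, b)`. -/
abbrev kappa (b : Set.Ioi (0 : ℝ)) : PersistenceModule.{0} := interval (Set.Ico 0 b.1)

/-- The interval module of `[0, ∞)`. -/
abbrev kappaInfty : PersistenceModule.{0} := interval (Set.Ici (0 : ℝ))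

/-- The morphism from the interval module of `[0, a)` to that of `[0, b)`, where `b ≤ a`, which is
the identity of `ZMod 2` at every `t ∈ [0, b)` and zero at every other `t`. -/
def kappaMap {a b : Set.Ioi (0 : ℝ)} (hab : b ≤ a) : Hom (kappa a) (kappa b) where
  app t := intervalSpaceMap (Set.Ico 0 a.1) (Set.Ico 0 b.1) t t
  naturality {s t} h x := by
    refine Subtype.ext ?_
    by_cases ht : t ∈ Set.Ico 0 b.1
    · have ht' : t ∈ Set.Ico 0 a.1 := ⟨ht.1, lt_of_lt_of_le ht.2 hab⟩
      refine (intervalSpaceMap_of_mem ht _).trans (Eq.trans ?_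
        ((intervalSpaceMap_of_mem ht _).trans (intervalSpaceMap_of_mem ht' x)).symm)
      by_cases hs : s ∈ Set.Ico 0 b.1
      · exact intervalSpaceMap_of_mem hs x
      · have hs' : s ∉ Set.Ico 0 a.1 := fun hs' => hs ⟨hs'.1, lt_of_le_of_lt h ht.2⟩
        exact (intervalSpaceMap_of_notMem hs x).trans (x.2 hs').symm
    · exact (intervalSpaceMap_of_notMem ht _).trans (intervalSpaceMap_of_notMem ht _).symm

/-- A bounded interval `[p, q)` of the real line, given by its endpoints `p < q`. -/
abbrev BoundedInterval : Type := {J : ℝ × ℝ // J.1 < J.2}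

/-- `IsBarcode U m` says that the multiset of bounded intervals in which `J` has multiplicity
`m J` is the barcode of `U`: the module `U` is isomorphic to the direct sum of `m J` copies of the
interval module of `J`, for every `J`, and of one interval module of `[0, ∞)`. (The infinite
interval is not counted as an element of the barcode.) -/
def IsBarcode (U : PersistenceModule.{u}) (m : BoundedInterval → ℕ) : Prop :=
  Nonempty (Iso U (prod
    (directSum fun j : (J : BoundedInterval) × Fin (m J) =>
      interval (Set.Ico j.1.1.1 j.1.1.2))
    kappaInfty))

/-- The classes at time `0` that die at time `b` or before. -/
def kerPlus (U : PersistenceModule.{u}) (b : Set.Ioi (0 : ℝ)) :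
    Submodule (ZMod 2) (U.space 0) :=
  LinearMap.ker (U.map b.2.le)

/-- The classes at time `0` that die before time `b`; see `mem_kerMinus`. -/
def kerMinus (U : PersistenceModule.{u}) (b : Set.Ioi (0 : ℝ)) :
    Submodule (ZMod 2) (U.space 0) :=
  ⨆ r : Set.Ico (0 : ℝ) b.1, LinearMap.ker (U.map r.2.1)

/-- The subspace `kerMinus` is the union of the kernels of the structure maps from time `0` to
the times `r` with `0 ≤ r < b`. -/
theorem mem_kerMinus (U : PersistenceModule.{u}) (b : Set.Ioi (0 : ℝ)) (x : U.space 0) :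
    x ∈ kerMinus U b ↔ ∃ r : Set.Ico (0 : ℝ) b.1, x ∈ LinearMap.ker (U.map r.2.1) := by
  have : Nonempty (Set.Ico (0 : ℝ) b.1) := ⟨⟨0, le_refl _, b.2⟩⟩
  have key : ∀ r s : Set.Ico (0 : ℝ) b.1, r ≤ s →
      LinearMap.ker (U.map r.2.1) ≤ LinearMap.ker (U.map s.2.1) := by
    intro r s hrs y hy
    rw [LinearMap.mem_ker] at hy ⊢
    have h := U.map_comp r.2.1 hrs y
    rw [hy, map_zero] at h
    exact h.symm
  refine Submodule.mem_iSup_of_directed _ fun r s => ?_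
  rcases le_total r s with h | h
  · exact ⟨s, key r s h, le_refl _⟩
  · exact ⟨r, le_refl _, key s r h⟩

/-- The block function of a persistence morphism `f` at `(a, b)`: the dimension of the quotient of
`f₀ (ker⁺ₐ V) ∩ ker⁺_b U` by `f₀ (ker⁻ₐ V) ∩ ker⁺_b U + f₀ (ker⁺ₐ V) ∩ ker⁻_b U`. -/
def blockFunction {V : PersistenceModule.{u}} {U : PersistenceModule.{v}} (f : Hom V U)
    (a b : Set.Ioi (0 : ℝ)) : ℕ :=
  Module.finrank (ZMod 2)
    (↥((kerPlus V a).map (f.app 0) ⊓ kerPlus U b) ⧸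
      (((kerMinus V a).map (f.app 0) ⊓ kerPlus U b) ⊔
        ((kerPlus V a).map (f.app 0) ⊓ kerMinus U b)).submoduleOf
          ((kerPlus V a).map (f.app 0) ⊓ kerPlus U b))

/-- The multiplicity of `[0, b)` in the barcode `m` of the codomain, minus the sum over `a > 0` of
the values of the block function at `(a, b)`; as an integer. -/
def unmatched {V : PersistenceModule.{u}} {U : PersistenceModule.{v}} (f : Hom V U)
    (m : BoundedInterval → ℕ) (b : Set.Ioi (0 : ℝ)) : ℤ :=
  (m ⟨(0, b.1), b.2⟩ : ℤ) - ∑ᶠ a : Set.Ioi (0 : ℝ), (blockFunction f a b : ℤ)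

end PersistenceModule

open PersistenceModule in
/-- A ladder: a persistence morphism together with its domain and codomain. -/
structure Ladder where
  dom : PersistenceModule.{u}
  cod : PersistenceModule.{v}
  hom : Hom dom cod

namespace Ladder

open PersistenceModule

/-- An isomorphism of ladders: isomorphisms of the domains and of the codomains that commute with
the two morphisms. -/
structure Iso (F : Ladder.{u, v}) (G : Ladder.{u', v'}) where
  domIso : PersistenceModule.Iso F.dom G.dom
  codIso : PersistenceModule.Iso F.cod G.cod
  comm : ∀ (t : ℝ) (x : F.dom.space t),
    codIso.app t (F.hom.app t x) = G.hom.app t (domIso.app t x)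

/-- The direct sum of a family of ladders. -/
def directSum {ι : Type w} (F : ι → Ladder.{u, v}) : Ladder.{max w u, max w v} where
  dom := PersistenceModule.directSum fun i => (F i).dom
  cod := PersistenceModule.directSum fun i => (F i).cod
  hom :=
    { app := fun t => DirectSum.lmap fun i => (F i).hom.app t
      naturality := fun {s _} h (x : DirectSum ι fun i => (F i).dom.space s) =>
        DFinsupp.ext fun i => (F i).hom.naturality h (x i) }

/-- The direct sum of two ladders. -/
def prod (F : Ladder.{u, v}) (G : Ladder.{u', v'}) : Ladder.{max u u', max v v'} where
  dom := PersistenceModule.prod F.dom G.dom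
  cod := PersistenceModule.prod F.cod G.cod
  hom :=
    { app := fun t => (F.hom.app t).prodMap (G.hom.app t)
      naturality := fun h x => Prod.ext (F.hom.naturality h x.1) (G.hom.naturality h x.2) }

/-- The ladder `κ_a → κ_b`, for `b ≤ a`. -/
def kappaKappa {a b : Set.Ioi (0 : ℝ)} (hab : b ≤ a) : Ladder.{0, 0} :=
  ⟨kappa a, kappa b, kappaMap hab⟩

/-- The ladder `0 → κ_b`. -/
def zeroKappa (b : Set.Ioi (0 : ℝ)) : Ladder.{0, 0} :=
  ⟨PersistenceModule.zero, kappa b, Hom.zero _ _⟩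

/-- The ladder `κ_a → 0`. -/
def kappaZero (a : Set.Ioi (0 : ℝ)) : Ladder.{0, 0} :=
  ⟨kappa a, PersistenceModule.zero, Hom.zero _ _⟩

/-- The ladder `κ_∞ → κ_∞` given by the identity. -/
def kappaInftyKappaInfty : Ladder.{0, 0} :=
  ⟨kappaInfty, kappaInfty, Hom.id _⟩

end Ladder

namespace VietorisRips

/-- The graph `VR_r(X)`: its vertices are the points of `X` if `0 ≤ r` (there are none if `r < 0`),
and two distinct vertices are adjacent when their distance is at most `r`. -/
def graph (X : Type u) [MetricSpace X] (r : ℝ) : SimpleGraph {_x : X // 0 ≤ r} where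
  Adj x y := x ≠ y ∧ dist x.1 y.1 ≤ r
  symm := ⟨fun x y h => ⟨h.1.symm, by rw [dist_comm]; exact h.2⟩⟩
  loopless := ⟨fun _ h => h.1 rfl⟩

/-- The set of connected components of `VR_r(X)`. -/
abbrev Components (X : Type u) [MetricSpace X] (r : ℝ) : Type u :=
  (graph X r).ConnectedComponent

/-- The map on connected components, from `VR_r(X)` to `VR_s(Z)` with `r ≤ s`, that is induced by
a non-expansive map. -/
def componentsMap {X : Type u} {Z : Type v} [MetricSpace X] [MetricSpace Z] (f : X → Z)
    (hf : ∀ x y, dist (f x) (f y) ≤ dist x y) {r s : ℝ} (hrs : r ≤ s) :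
    Components X r → Components Z s :=
  Quot.lift (fun x => (graph Z s).connectedComponentMk ⟨f x.1, x.2.trans hrs⟩) (by
    rintro x y ⟨p⟩
    induction p with
    | nil => rfl
    | @cons y z _ h _ ih =>
      refine Eq.trans (SimpleGraph.ConnectedComponent.sound ?_) ih
      by_cases he : f y.1 = f z.1
      · simp only [he]
        exact SimpleGraph.Reachable.refl _
      · exact SimpleGraph.Adj.reachable
          ⟨fun h' => he (congrArg Subtype.val h'), (hf _ _).trans (h.2.trans hrs)⟩)

/-- The 0-persistent homology over `ZMod 2` of the Vietoris-Rips filtration of `X`: the free vector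
spaces on the sets of connected components of the graphs `VR_r(X)`, with the maps induced by the
inclusions of graphs. -/
def PH0 (X : Type u) [MetricSpace X] : PersistenceModule.{u} where
  space r := Components X r →₀ ZMod 2
  map h := Finsupp.lmapDomain (ZMod 2) (ZMod 2) (componentsMap id (fun _ _ => le_refl _) h)
  map_self t x := by
    have h : componentsMap (X := X) id (fun _ _ => le_refl _) (le_refl t) = id := by
      funext c
      induction c using SimpleGraph.ConnectedComponent.ind
      rfl
    rw [h, Finsupp.lmapDomain_id, LinearMap.id_apply]
  map_comp hrs hst x := by
    refine Finsupp.mapDomain_comp.symm.trans (congrArg (fun k => Finsupp.mapDomain k x) ?_)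
    funext c
    induction c using SimpleGraph.ConnectedComponent.ind
    rfl

/-- The persistence morphism induced by a non-expansive map. -/
def PH0Map {X : Type u} {Z : Type v} [MetricSpace X] [MetricSpace Z] (f : X → Z)
    (hf : ∀ x y, dist (f x) (f y) ≤ dist x y) : PersistenceModule.Hom (PH0 X) (PH0 Z) where
  app t := Finsupp.lmapDomain (ZMod 2) (ZMod 2) (componentsMap f hf (le_refl t))
  naturality h x := by
    refine Finsupp.mapDomain_comp.symm.trans
      (Eq.trans (congrArg (fun k => Finsupp.mapDomain k x) ?_) Finsupp.mapDomain_comp)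
    funext c
    induction c using SimpleGraph.ConnectedComponent.ind
    rfl

end VietorisRips

end

/-!
Both modules `V = PH0 X` and `U = PH0 Z` vanish before time `0`, and every class at a later time
comes from time `0`, because all vertices of the Vietoris-Rips graphs are there from the start.
Such a module is determined by the vector space at time `0` and the increasing family of the
kernels of the structure maps out of it, and a morphism of such modules is determined by its value
at time `0` (`GeneratedAtZero.exists_iso`, `AdaptedPair.nonempty_iso`).

Since `g` is injective and no graph has an edge at time `0`, the map `f₀ : V₀ → U₀` is injective.
Thus `U₀` carries two chains of subspaces: the kernels of `U`, and the images under `f₀` of the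
kernels of `V` together with `f₀ V₀`. Two chains of subspaces always have a common adapted basis
(`Submodule.exists_basis_adapted_to_chains`), and the basis vectors that lie in `f₀ V₀` lift to a
basis of `V₀` that is adapted to the kernels of `V` (`AdaptedPair.exists_of_injective`). For finite
metric spaces the kernels change only at finitely many times, where they already have the new
value, so each basis vector either never dies or has a first time at which it is zero, its death
time. A basis vector of `f₀ V₀` which dies at `a` in `V` and at `b` in `U` spans a copy of
`κ_a → κ_b`; naturality gives `b ≤ a`. A basis vector outside `f₀ V₀` which dies at `b` spans a
copy of `0 → κ_b`. Late graphs are complete, so exactly one basis vector never dies; it lies in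
`f₀ V₀` and spans `κ_∞ → κ_∞` (`VietorisRips.existsUnique_death_eq_top`,
`VietorisRips.death_index_eq_top_iff`).

The multiplicities are found by counting basis vectors: all subspaces in the definition of the
block function are spanned by basis vectors (`AdaptedPair.blockFunction_eq`), and the multiplicity
of `[0, b)` in any barcode of `U` is the number of basis vectors that die at `b`
(`IsBarcode.apply_eq`). The difference of the two counts is the number of basis vectors outside
`f₀ V₀` that die at `b` (`AdaptedPair.unmatched_eq`). Finally, `κ_a → 0` is not a summand because
`f₀` is injective.
-/

noncomputable section

/-! ### Bases adapted to two chains of subspaces -/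

/-- Any two chains of subspaces of a finite-dimensional space have a common adapted basis. The
relative form, inside a subspace `H`, is what the induction on `H` needs: a hyperplane `H'` of `H`
that contains all proper traces `H ⊓ F`, `F ∈ 𝓕`, has a suitable basis, and it is enough to add a
vector outside `H'` that lies in the smallest member of `𝓖` which has such a vector. -/
theorem Submodule.exists_linearIndepOn_adapted_to_chains {K : Type*} {W : Type*} [Field K]
    [AddCommGroup W] [Module K W] [FiniteDimensional K W] {𝓕 𝓖 : Set (Submodule K W)}
    (h𝓕 : IsChain (· ≤ ·) 𝓕) (h𝓖 : IsChain (· ≤ ·) 𝓖) (H : Submodule K W) :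
    ∃ B : Set W, LinearIndepOn K id B ∧ Submodule.span K B = H ∧
      (∀ F ∈ 𝓕, H ⊓ F ≤ Submodule.span K (B ∩ F)) ∧
      (∀ G ∈ 𝓖, H ⊓ G ≤ Submodule.span K (B ∩ G)) := by
  induction H using WellFoundedLT.induction with
  | _ H ih =>
  rcases eq_or_ne H ⊥ with rfl | hH
  · exact ⟨∅, linearIndepOn_empty K id, by simp, by simp, by simp⟩
  -- a maximal proper trace of the first chain
  obtain ⟨M, hMH, hM⟩ : ∃ M : Submodule K W, M < H ∧ ∀ F ∈ 𝓕, H ⊓ F ≠ H → H ⊓ F ≤ M := by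
    by_cases hne : ∃ N, ∃ F ∈ 𝓕, H ⊓ F = N ∧ N ≠ H
    · obtain ⟨N, ⟨F, hF, rfl, hFH⟩, hmax⟩ := WellFounded.has_min
        (wellFounded_gt (α := Submodule K W)) {N | ∃ F ∈ 𝓕, H ⊓ F = N ∧ N ≠ H} hne
      refine ⟨H ⊓ F, lt_of_le_of_ne inf_le_left hFH, fun F₂ hF₂ hne₂ => ?_⟩
      rcases h𝓕.total hF hF₂ with h | h
      · rcases (inf_le_inf_left H h).lt_or_eq with h4 | h4
        · exact (hmax _ ⟨F₂, hF₂, rfl, hne₂⟩ h4).elim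
        · exact h4.ge
      · exact inf_le_inf_left _ h
    · push Not at hne
      exact ⟨⊥, bot_lt_iff_ne_bot.2 hH, fun F hF h => (h (hne _ F hF rfl)).elim⟩
  obtain ⟨H', hMH', hcov⟩ := exists_le_covBy_of_lt hMH
  obtain ⟨B, hB, hBspan, hB𝓕, hB𝓖⟩ := ih H' hcov.lt
  -- a new vector, in the smallest possible member of the second chain
  obtain ⟨v, hvH, hvH', hv⟩ : ∃ v ∈ H, v ∉ H' ∧ ∀ G ∈ 𝓖, ¬ H ⊓ G ≤ H' → v ∈ G := by
    by_cases hne : ∃ G ∈ 𝓖, ¬ H ⊓ G ≤ H'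
    · obtain ⟨G, ⟨hG, hGH⟩, hmin⟩ := WellFounded.has_min
        (wellFounded_lt (α := Submodule K W)) {G | G ∈ 𝓖 ∧ ¬ H ⊓ G ≤ H'} hne
      obtain ⟨v, hv, hv'⟩ := SetLike.not_le_iff_exists.1 hGH
      refine ⟨v, hv.1, hv', fun G₂ hG₂ hn => ?_⟩
      rcases h𝓖.total hG hG₂ with h | h
      · exact h hv.2
      · rcases h.lt_or_eq with h4 | rfl
        · exact (hmin _ ⟨hG₂, hn⟩ h4).elim
        · exact hv.2
    · push Not at hne
      obtain ⟨v, hv, hv'⟩ := SetLike.exists_of_lt hcov.lt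
      exact ⟨v, hv, hv', fun G hG h => (h (hne G hG)).elim⟩
  have hsup : H' ⊔ Submodule.span K {v} = H := by
    rcases hcov.eq_or_eq (c := H' ⊔ Submodule.span K {v}) le_sup_left
      (sup_le hcov.le (by simpa using hvH)) with h | h
    · exact (hvH' (h ▸ Submodule.mem_sup_right (Submodule.mem_span_singleton_self v))).elim
    · exact h
  have hspan : Submodule.span K (insert v B) = H := by
    rw [Submodule.span_insert, hBspan, sup_comm, hsup]
  have hold : ∀ F : Submodule K W, H' ⊓ F ≤ Submodule.span K (B ∩ F) → H ⊓ F ≤ H' →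
      H ⊓ F ≤ Submodule.span K (insert v B ∩ F) := fun F hF h =>
    (le_inf h inf_le_right).trans (hF.trans (Submodule.span_mono
      (Set.inter_subset_inter_left _ (Set.subset_insert _ _))))
  have hnew : ∀ F : Submodule K W, H' ⊓ F ≤ Submodule.span K (B ∩ F) → v ∈ F →
      H ⊓ F ≤ Submodule.span K (insert v B ∩ F) := by
    rintro F hF hvF x ⟨hxH, hxF⟩
    rw [SetLike.mem_coe, ← hsup] at hxH
    obtain ⟨y, hy, z, hz, rfl⟩ := Submodule.mem_sup.1 hxH
    obtain ⟨c, rfl⟩ := Submodule.mem_span_singleton.1 hz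
    have hyF : y ∈ F := by
      have := F.sub_mem hxF (F.smul_mem c hvF)
      simpa using this
    refine add_mem (Submodule.span_mono (Set.inter_subset_inter_left _ (Set.subset_insert _ _))
      (hF ⟨hy, hyF⟩)) (Submodule.smul_mem _ _ (Submodule.subset_span ⟨Set.mem_insert _ _, hvF⟩))
  refine ⟨insert v B, ?_, hspan, fun F hF => ?_, fun G hG => ?_⟩
  · refine (linearIndepOn_id_insert fun hvB => hvH' ?_).2 ⟨hB, ?_⟩
    · rw [← hBspan]; exact Submodule.subset_span hvB
    · rwa [hBspan]
  · by_cases h : H ⊓ F = H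
    · exact hnew F (hB𝓕 F hF) ((inf_eq_left.1 h) hvH)
    · exact hold F (hB𝓕 F hF) ((hM F hF h).trans hMH')
  · by_cases h : H ⊓ G ≤ H'
    · exact hold G (hB𝓖 G hG) h
    · exact hnew G (hB𝓖 G hG) (hv G hG h)

/-- The basis form of `Submodule.exists_linearIndepOn_adapted_to_chains`: the coordinates of a
vector of a member of either chain vanish at the basis vectors outside that member. -/
theorem Submodule.exists_basis_adapted_to_chains {K : Type*} {W : Type*} [Field K]
    [AddCommGroup W] [Module K W] [FiniteDimensional K W] {𝓕 𝓖 : Set (Submodule K W)}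
    (h𝓕 : IsChain (· ≤ ·) 𝓕) (h𝓖 : IsChain (· ≤ ·) 𝓖) :
    ∃ (B : Set W) (e : Module.Basis B K W),
      ∀ F ∈ 𝓕 ∪ 𝓖, ∀ x ∈ F, ∀ i, e.repr x i ≠ 0 → e i ∈ F := by
  obtain ⟨B, hB, hspan, hF, hG⟩ := Submodule.exists_linearIndepOn_adapted_to_chains h𝓕 h𝓖 ⊤
  let e : Module.Basis B K W := Module.Basis.mk (v := fun i : B => (i : W)) hB
    (by rw [Subtype.range_coe, hspan])
  have he : ∀ i : B, e i = i := fun i => Module.Basis.mk_apply _ _ i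
  refine ⟨B, e, fun F hF' x hx i hi => ?_⟩
  have hle : F ≤ Submodule.span K (B ∩ F) := by
    rcases hF' with h | h
    · simpa using hF F h
    · simpa using hG F h
  have himg : B ∩ F = e '' {i | e i ∈ F} := by
    ext y
    constructor
    · rintro ⟨h1, h2⟩
      exact ⟨⟨y, h1⟩, show e ⟨y, h1⟩ ∈ F from (he ⟨y, h1⟩).symm ▸ h2, he _⟩
    · rintro ⟨⟨y, h1⟩, h2, rfl⟩
      exact ⟨(he ⟨y, h1⟩).symm ▸ h1, h2⟩
  have hx' := hle hx
  rw [himg] at hx'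
  exact (e.mem_span_image.1 hx') (Finsupp.mem_support_iff.2 hi)

section CoordinateSubspaces

variable {K : Type*} {W : Type*} {κ : Type*} [Field K] [AddCommGroup W] [Module K W]

theorem Module.Basis.mem_span_image_iff_repr (e : Module.Basis κ K W) (s : Set κ) (x : W) :
    x ∈ Submodule.span K (e '' s) ↔ ∀ i, i ∉ s → e.repr x i = 0 := by
  rw [e.mem_span_image]
  constructor
  · intro h i hi
    by_contra hne
    exact hi (h (Finsupp.mem_support_iff.2 hne))
  · intro h i hi
    by_contra hne
    exact Finsupp.mem_support_iff.1 hi (h i hne)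

theorem Module.Basis.span_image_inf (e : Module.Basis κ K W) (s t : Set κ) :
    Submodule.span K (e '' s) ⊓ Submodule.span K (e '' t) = Submodule.span K (e '' (s ∩ t)) := by
  ext x
  simp only [Submodule.mem_inf, e.mem_span_image_iff_repr, Set.mem_inter_iff]
  grind

theorem Module.Basis.finrank_span_image (e : Module.Basis κ K W) [Finite κ] (s : Set κ) :
    Module.finrank K (Submodule.span K (e '' s)) = s.ncard := by
  have := Fintype.ofFinite κ
  classical
  rw [Set.image_eq_range]
  refine (finrank_span_eq_card (e.linearIndependent.comp _ Subtype.val_injective)).trans ?_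
  rw [← Nat.card_coe_set_eq, Nat.card_eq_fintype_card]

/-- The dimension of a quotient of two nested coordinate subspaces. -/
theorem Module.Basis.finrank_span_image_quotient (e : Module.Basis κ K W) [Finite κ] {s t : Set κ}
    (h : t ⊆ s) :
    Module.finrank K (↥(Submodule.span K (e '' s)) ⧸
      (Submodule.span K (e '' t)).submoduleOf (Submodule.span K (e '' s))) = (s \ t).ncard := by
  have := e.finiteDimensional_of_finite
  have h1 := Submodule.finrank_quotient_add_finrank
    ((Submodule.span K (e '' t)).submoduleOf (Submodule.span K (e '' s)))
  rw [(Submodule.submoduleOfEquivOfLe (Submodule.span_mono (Set.image_mono h))).finrank_eq,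
    e.finrank_span_image, e.finrank_span_image] at h1
  have h2 := Set.ncard_sdiff_add_ncard_of_subset h
  omega

end CoordinateSubspaces

/-! ### Persistence modules that are generated at time zero -/

namespace PersistenceModule

/-- A persistence module is generated at time `0` if it vanishes before time `0` and all classes
at later times come from time `0`. Up to isomorphism, such a module is the vector space at time
`0` together with the kernels of the structure maps out of it. -/
structure GeneratedAtZero (V : PersistenceModule.{u}) : Prop where
  eq_zero_of_neg : ∀ t : ℝ, t < 0 → ∀ x : V.space t, x = 0
  surjective : ∀ {t : ℝ} (h : 0 ≤ t), Function.Surjective (V.map h)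

namespace GeneratedAtZero

theorem zero : GeneratedAtZero zero where
  eq_zero_of_neg _ _ _ := rfl
  surjective _ _ := ⟨PUnit.unit, rfl⟩

theorem interval {I : Set ℝ} [I.OrdConnected] (h0 : 0 ∈ I) (hI : ∀ t ∈ I, 0 ≤ t) :
    GeneratedAtZero (interval I) where
  eq_zero_of_neg t ht x := Subtype.ext (x.2 fun h => (hI t h).not_gt ht)
  surjective {t} h x := by
    refine ⟨⟨x.1, fun h' => (h' h0).elim⟩, Subtype.ext ?_⟩
    by_cases ht : t ∈ I
    · exact intervalSpaceMap_of_mem ht _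
    · exact (intervalSpaceMap_of_notMem ht _).trans (x.2 ht).symm

theorem directSum {ι : Type w} {V : ι → PersistenceModule.{u}} (hV : ∀ i, GeneratedAtZero (V i)) :
    GeneratedAtZero (directSum V) where
  eq_zero_of_neg t ht _ := DFinsupp.ext fun i => (hV i).eq_zero_of_neg t ht _
  surjective h := by
    refine (DirectSum.lmap_surjective _).2 fun i => (hV i).surjective h

theorem prod {V : PersistenceModule.{u}} {U : PersistenceModule.{v}} (hV : GeneratedAtZero V)
    (hU : GeneratedAtZero U) : GeneratedAtZero (prod V U) where
  eq_zero_of_neg t ht _ := Prod.ext (hV.eq_zero_of_neg t ht _) (hU.eq_zero_of_neg t ht _)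
  surjective h := (hV.surjective h).prodMap (hU.surjective h)

/-- A linear isomorphism at time `0` that matches the kernels of the structure maps extends to
all times. -/
theorem exists_iso {V : PersistenceModule.{u}} {U : PersistenceModule.{v}} (hV : GeneratedAtZero V)
    (hU : GeneratedAtZero U) (e : V.space 0 ≃ₗ[ZMod 2] U.space 0)
    (he : ∀ {t : ℝ} (h : 0 ≤ t) (x : V.space 0), V.map h x = 0 ↔ U.map h (e x) = 0) :
    ∃ E : Iso V U, ∀ {t : ℝ} (h : 0 ≤ t) (x : V.space 0),
      E.app t (V.map h x) = U.map h (e x) := by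
  have key : ∀ t : ℝ, ∃ E : V.space t ≃ₗ[ZMod 2] U.space t, ∀ (h : 0 ≤ t) (x : V.space 0),
      E (V.map h x) = U.map h (e x) := by
    intro t
    by_cases h : 0 ≤ t
    · have hmap : (LinearMap.ker (V.map h)).map (e : V.space 0 →ₗ[ZMod 2] U.space 0) =
          LinearMap.ker (U.map h) := by
        ext y
        obtain ⟨x, rfl⟩ := e.surjective y
        simp [he h]
      refine ⟨((V.map h).quotKerEquivOfSurjective (hV.surjective h)).symm.trans
        ((Submodule.Quotient.equiv _ _ e hmap).trans
          ((U.map h).quotKerEquivOfSurjective (hU.surjective h))), fun _ x => ?_⟩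
      have : ((V.map h).quotKerEquivOfSurjective (hV.surjective h)).symm (V.map h x) =
          Submodule.Quotient.mk x := by
        rw [LinearEquiv.symm_apply_eq]
        rfl
      rw [LinearEquiv.trans_apply, this]
      rfl
    · have : Subsingleton (V.space t) :=
        ⟨fun x y => by rw [hV.eq_zero_of_neg t (not_le.1 h) x, hV.eq_zero_of_neg t (not_le.1 h) y]⟩
      have : Subsingleton (U.space t) :=
        ⟨fun x y => by rw [hU.eq_zero_of_neg t (not_le.1 h) x, hU.eq_zero_of_neg t (not_le.1 h) y]⟩
      exact ⟨0, fun h' => (h h').elim⟩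
  choose E hE using key
  refine ⟨⟨E, fun {s t} h x => ?_⟩, fun {t} h x => hE t h x⟩
  by_cases hs : 0 ≤ s
  · obtain ⟨y, rfl⟩ := hV.surjective hs x
    rw [hE, V.map_comp, U.map_comp, hE]
  · rw [hV.eq_zero_of_neg s (not_le.1 hs) x]
    simp

end GeneratedAtZero

/-! ### Bases at time zero that are adapted to the death times -/

/-- A basis of the classes at time `0` with a death time for each basis vector (`⊤` for a class
that never dies), such that the kernel of the structure map to time `t ≥ 0` is spanned by the
basis vectors that die at time `t` or before. -/
structure AdaptedBasis (V : PersistenceModule.{u}) (κ : Type w) where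
  basis : Module.Basis κ (ZMod 2) (V.space 0)
  death : κ → WithTop ℝ
  map_eq_zero_iff : ∀ {t : ℝ} (h : 0 ≤ t) (x : V.space 0),
    V.map h x = 0 ↔ ∀ i, (t : WithTop ℝ) < death i → basis.repr x i = 0

namespace AdaptedBasis

/-- The empty basis of the zero module. -/
def zero : AdaptedBasis PersistenceModule.zero PEmpty.{w + 1} where
  basis := Module.Basis.empty (ι := PEmpty.{w + 1}) (M := PUnit.{1})
  death := PEmpty.elim
  map_eq_zero_iff _ _ := ⟨fun _ i => i.elim, fun _ => rfl⟩

open Classical in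
/-- The basis of an interval module, with at most one element, where `d` is the right end of the
interval. The index type `PLift (0 ∈ I)` is empty if the module vanishes at time `0`. -/
def interval (I : Set ℝ) [I.OrdConnected] (d : WithTop ℝ)
    (hd : 0 ∈ I → ∀ t : ℝ, 0 ≤ t → (t ∈ I ↔ (t : WithTop ℝ) < d)) :
    AdaptedBasis (interval I) (PLift (0 ∈ I)) where
  basis := .ofRepr
    { toFun := fun x => Finsupp.equivFunOnFinite.symm fun _ => x.1
      map_add' := fun x y => by ext; rfl
      map_smul' := fun c x => by ext; rfl
      invFun := fun c => ⟨if h : 0 ∈ I then c ⟨h⟩ else 0, fun h => dif_neg h⟩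
      left_inv := fun x => by
        refine Subtype.ext ?_
        by_cases h : 0 ∈ I
        · simp [h]
        · simp [h, x.2 h]
      right_inv := fun c => by
        ext i
        simp [i.down] }
  death _ := d
  map_eq_zero_iff {t} h x := by
    by_cases h0 : 0 ∈ I
    · have hx : ∀ y : intervalSpace I 0,
          intervalSpaceMap I I 0 t y = 0 ↔ (t ∈ I → y.1 = 0) := by
        intro y
        rw [Subtype.ext_iff]
        by_cases ht : t ∈ I
        · simp [intervalSpaceMap_of_mem, ht]
        · simp [intervalSpaceMap_of_notMem, ht]
      refine (hx x).trans ?_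
      rw [hd h0 t h]
      exact ⟨fun h' _ => h', fun h' => h' ⟨h0⟩⟩
    · have : x = 0 := Subtype.ext (x.2 h0)
      subst this
      exact ⟨fun _ i => (h0 i.down).elim, fun _ => map_zero _⟩

/-- The union of two adapted bases, in a direct sum of two modules. -/
def prod {V : PersistenceModule.{u}} {U : PersistenceModule.{v}} {κ : Type w} {κ' : Type w'}
    (A : AdaptedBasis V κ) (B : AdaptedBasis U κ') :
    AdaptedBasis (PersistenceModule.prod V U) (κ ⊕ κ') where
  basis := A.basis.prod B.basis
  death := Sum.elim A.death B.death
  map_eq_zero_iff {t} h x := by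
    have hx : (PersistenceModule.prod V U).map h x = 0 ↔ V.map h x.1 = 0 ∧ U.map h x.2 = 0 :=
      Prod.ext_iff
    rw [hx, A.map_eq_zero_iff, B.map_eq_zero_iff, Sum.forall]
    rfl

/-- The union of a family of adapted bases, in a direct sum of modules. -/
def directSum {ι : Type w} {V : ι → PersistenceModule.{u}} {κ : ι → Type w'}
    (A : ∀ i, AdaptedBasis (V i) (κ i)) :
    AdaptedBasis (PersistenceModule.directSum V) (Σ i, κ i) where
  basis := DFinsupp.basis fun i => (A i).basis
  death k := (A k.1).death k.2
  map_eq_zero_iff {t} h x := by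
    have hx : ∀ y : DirectSum ι fun i => (V i).space 0,
        (PersistenceModule.directSum V).map h y = 0 ↔ ∀ i, (V i).map h (y i) = 0 :=
      fun y => DFinsupp.ext_iff
    refine (hx x).trans ?_
    simp only [(A _).map_eq_zero_iff, Sigma.forall]
    rfl

/-- Two modules that are generated at time `0` and have adapted bases with the same death times
are isomorphic. -/
theorem exists_iso {V : PersistenceModule.{u}} {U : PersistenceModule.{v}} {κ : Type w}
    {κ' : Type w'} (A : AdaptedBasis V κ) (B : AdaptedBasis U κ') (hV : GeneratedAtZero V)
    (hU : GeneratedAtZero U) (φ : κ ≃ κ') (hφ : ∀ i, B.death (φ i) = A.death i) :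
    ∃ E : Iso V U, ∀ {t : ℝ} (h : 0 ≤ t) (x : V.space 0),
      E.app t (V.map h x) = U.map h (A.basis.equiv B.basis φ x) := by
  refine hV.exists_iso hU _ fun {t} h x => ?_
  have hrepr : ∀ i, B.basis.repr (A.basis.equiv B.basis φ x) (φ i) = A.basis.repr x i := by
    have h' : A.basis.equiv B.basis φ = (A.basis.reindex φ).repr.trans B.basis.repr.symm :=
      A.basis.ext' fun i => by simp
    intro i
    rw [h', LinearEquiv.trans_apply, LinearEquiv.apply_symm_apply]
    simp
  rw [A.map_eq_zero_iff, B.map_eq_zero_iff, ← φ.forall_congr_right]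
  simp only [hφ, hrepr]

/-- Adapted bases transport along isomorphisms. -/
def ofIso {V : PersistenceModule.{u}} {U : PersistenceModule.{v}} {κ : Type w}
    (A : AdaptedBasis U κ) (E : Iso V U) : AdaptedBasis V κ where
  basis := A.basis.map (E.app 0).symm
  death := A.death
  map_eq_zero_iff {t} h x := by
    rw [← (E.app t).map_eq_zero_iff, ← E.naturality, A.map_eq_zero_iff]
    rfl

section Kernels

variable {V : PersistenceModule.{u}} {κ : Type w} (A : AdaptedBasis V κ) (b : Set.Ioi (0 : ℝ))

theorem kerPlus_eq_span :
    kerPlus V b = Submodule.span (ZMod 2) (A.basis '' {i | A.death i ≤ (b.1 : ℝ)}) := by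
  ext x
  rw [A.basis.mem_span_image_iff_repr]
  simp only [kerPlus, LinearMap.mem_ker, A.map_eq_zero_iff, Set.mem_ofPred_eq, not_le]

theorem basis_mem_ker {t : ℝ} (h : 0 ≤ t) (i : κ) :
    V.map h (A.basis i) = 0 ↔ A.death i ≤ (t : ℝ) := by
  rw [A.map_eq_zero_iff]
  constructor
  · intro hi
    by_contra hlt
    simpa using hi i (not_le.1 hlt)
  · intro hi j hj
    rw [A.basis.repr_self, Finsupp.single_eq_of_ne]
    rintro rfl
    exact hi.not_gt hj

/-- The structure map from time `0` to time `0` is the identity, so it kills no basis vector. -/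
theorem death_pos (i : κ) : 0 < A.death i := by
  by_contra h
  have := (A.basis_mem_ker le_rfl i).2 (not_lt.1 h)
  rw [V.map_self] at this
  exact A.basis.ne_zero i this

/-- The supremum over the times `r < b` is reached at the death time of each basis vector. -/
theorem kerMinus_eq_span :
    kerMinus V b = Submodule.span (ZMod 2) (A.basis '' {i | A.death i < (b.1 : ℝ)}) := by
  apply le_antisymm
  · intro x hx
    obtain ⟨r, hr⟩ := (mem_kerMinus V b x).1 hx
    rw [LinearMap.mem_ker, A.map_eq_zero_iff] at hr
    rw [A.basis.mem_span_image_iff_repr]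
    intro i hi
    exact hr i (lt_of_lt_of_le (WithTop.coe_lt_coe.2 r.2.2) (not_lt.1 hi))
  · rw [Submodule.span_le]
    rintro _ ⟨i, hi, rfl⟩
    have htop : A.death i ≠ ⊤ := fun h => by
      rw [Set.mem_ofPred_eq, h] at hi
      exact not_top_lt hi
    obtain ⟨r, hr⟩ := WithTop.ne_top_iff_exists.1 htop
    have hpos := A.death_pos i
    rw [Set.mem_ofPred_eq, ← hr, WithTop.coe_lt_coe] at hi
    rw [← hr] at hpos
    have hpos' : 0 < r := WithTop.coe_lt_coe.1 hpos
    exact (mem_kerMinus V b _).2 ⟨⟨r, hpos'.le, hi⟩, (A.basis_mem_ker hpos'.le i).2 hr.ge⟩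

/-- The number of basis vectors that die at time `b` does not depend on the adapted basis. -/
theorem ncard_death_eq [Finite κ] :
    {i | A.death i = (b.1 : ℝ)}.ncard =
      Module.finrank (ZMod 2) (kerPlus V b) - Module.finrank (ZMod 2) (kerMinus V b) := by
  have hsub : {i | A.death i < (b.1 : ℝ)} ⊆ {i | A.death i ≤ (b.1 : ℝ)} :=
    fun i (hi : A.death i < (b.1 : ℝ)) => hi.le
  rw [A.kerPlus_eq_span, A.kerMinus_eq_span, A.basis.finrank_span_image,
    A.basis.finrank_span_image, ← Set.ncard_sdiff hsub]
  congr 1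
  ext i
  simp only [Set.mem_sdiff, Set.mem_ofPred_eq, not_lt]
  exact ⟨fun h => ⟨h.le, h.ge⟩, fun h => le_antisymm h.1 h.2⟩

end Kernels

end AdaptedBasis

end PersistenceModule

/-! ### Adapted bases of ladders and the block function -/

theorem DFinsupp.basis_apply {ι R : Type*} {M : ι → Type*} {η : ι → Type*} [DecidableEq ι]
    [Semiring R] [∀ i, AddCommMonoid (M i)] [∀ i, Module R (M i)]
    (b : ∀ i, Module.Basis (η i) R (M i)) (k : Σ i, η i) :
    DFinsupp.basis b k = DFinsupp.single k.1 (b k.1 k.2) := by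
  apply (DFinsupp.basis b).repr.injective
  rw [Module.Basis.repr_self]
  have h : (DFinsupp.mapRange.linearEquiv fun i => (b i).repr) (DFinsupp.single k.1 (b k.1 k.2)) =
      sigmaFinsuppEquivDFinsupp (Finsupp.single k 1) := by
    rw [sigmaFinsuppEquivDFinsupp_single, DFinsupp.mapRange.linearEquiv_apply,
      DFinsupp.mapRange_single]
    simp
  exact ((Equiv.symm_apply_eq _).2 h).symm

namespace PersistenceModule

theorem AdaptedBasis.interval_basis_coe (I : Set ℝ) [I.OrdConnected] (d : WithTop ℝ)
    (hd : 0 ∈ I → ∀ t : ℝ, 0 ≤ t → (t ∈ I ↔ (t : WithTop ℝ) < d)) (i : PLift (0 ∈ I)) :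
    ((AdaptedBasis.interval I d hd).basis i : intervalSpace I 0).1 = 1 :=
  (dif_pos i.down).trans Finsupp.single_eq_same

/-- Adapted bases of the domain and the codomain of a morphism which, at time `0`, maps basis
vectors to basis vectors. -/
structure AdaptedPair {V : PersistenceModule.{u}} {U : PersistenceModule.{v}} (f : Hom V U)
    (κ : Type w) (κ' : Type w') where
  dom : AdaptedBasis V κ
  cod : AdaptedBasis U κ'
  index : κ → κ'
  hom_basis : ∀ i, f.app 0 (dom.basis i) = cod.basis (index i)

namespace AdaptedPair

section Sums

variable {F : Ladder.{u, v}} {G : Ladder.{u', v'}}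

/-- The union of the adapted bases of two ladders, in their direct sum. -/
def prod {κ κ' μ μ' : Type*} (P : AdaptedPair F.hom κ κ') (Q : AdaptedPair G.hom μ μ') :
    AdaptedPair (Ladder.prod F G).hom (κ ⊕ μ) (κ' ⊕ μ') where
  dom := P.dom.prod Q.dom
  cod := P.cod.prod Q.cod
  index := Sum.map P.index Q.index
  hom_basis i := by
    rcases i with i | i
    · have h1 : P.dom.basis.prod Q.dom.basis (Sum.inl i) = (P.dom.basis i, 0) := by simp
      have h2 : P.cod.basis.prod Q.cod.basis (Sum.inl (P.index i)) =
        (P.cod.basis (P.index i), 0) := by simp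
      exact (congrArg ((F.hom.app 0).prodMap (G.hom.app 0)) h1).trans
        (Eq.trans (by simp [P.hom_basis]) h2.symm)
    · have h1 : P.dom.basis.prod Q.dom.basis (Sum.inr i) = (0, Q.dom.basis i) := by simp
      have h2 : P.cod.basis.prod Q.cod.basis (Sum.inr (Q.index i)) =
        (0, Q.cod.basis (Q.index i)) := by simp
      exact (congrArg ((F.hom.app 0).prodMap (G.hom.app 0)) h1).trans
        (Eq.trans (by simp [Q.hom_basis]) h2.symm)

/-- The union of the adapted bases of a family of ladders, in their direct sum. -/
def directSum {ι : Type w} {F : ι → Ladder.{u, v}} {κ : ι → Type u'} {κ' : ι → Type v'}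
    (P : ∀ i, AdaptedPair (F i).hom (κ i) (κ' i)) :
    AdaptedPair (Ladder.directSum F).hom (Σ i, κ i) (Σ i, κ' i) where
  dom := AdaptedBasis.directSum fun i => (P i).dom
  cod := AdaptedBasis.directSum fun i => (P i).cod
  index k := ⟨k.1, (P k.1).index k.2⟩
  hom_basis k := by
    classical
    refine (congrArg _ (DFinsupp.basis_apply (fun i => (P i).dom.basis) k)).trans
      (Eq.trans ?_ (DFinsupp.basis_apply (fun i => (P i).cod.basis) _).symm)
    refine (DirectSum.lmap_lof (fun i => (F i).hom.app 0) k.1 ((P k.1).dom.basis k.2)).trans ?_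
    rw [(P k.1).hom_basis]
    rfl

end Sums

theorem mem_Ico_zero_iff_lt {b : ℝ} (_h : (0 : ℝ) ∈ Set.Ico 0 b) (t : ℝ) (ht : 0 ≤ t) :
    t ∈ Set.Ico 0 b ↔ (t : WithTop ℝ) < (b : ℝ) := by
  simp [ht]

/-- The adapted bases of `κ_a → κ_b`, with one element each. -/
def kappaKappa {a b : Set.Ioi (0 : ℝ)} (hab : b ≤ a) :
    AdaptedPair (Ladder.kappaKappa hab).hom (PLift ((0 : ℝ) ∈ Set.Ico 0 a.1))
      (PLift ((0 : ℝ) ∈ Set.Ico 0 b.1)) where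
  dom := AdaptedBasis.interval _ (a.1 : ℝ) mem_Ico_zero_iff_lt
  cod := AdaptedBasis.interval _ (b.1 : ℝ) mem_Ico_zero_iff_lt
  index _ := ⟨⟨le_rfl, b.2⟩⟩
  hom_basis i := by
    have h0 : (0 : ℝ) ∈ Set.Ico 0 b.1 := ⟨le_rfl, b.2⟩
    refine Subtype.ext ((intervalSpaceMap_of_mem (I := Set.Ico 0 a.1) h0 _).trans ?_)
    exact (AdaptedBasis.interval_basis_coe _ _ _ _).trans
      (AdaptedBasis.interval_basis_coe _ _ _ _).symm

/-- The adapted bases of `0 → κ_b`, with no and with one element. -/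
def zeroKappa (b : Set.Ioi (0 : ℝ)) :
    AdaptedPair (Ladder.zeroKappa b).hom PEmpty.{w + 1} (PLift ((0 : ℝ) ∈ Set.Ico 0 b.1)) where
  dom := AdaptedBasis.zero
  cod := AdaptedBasis.interval _ (b.1 : ℝ) mem_Ico_zero_iff_lt
  index := PEmpty.elim
  hom_basis i := i.elim

/-- The adapted bases of `κ_∞ → κ_∞`, with one element each. -/
def kappaInftyKappaInfty :
    AdaptedPair Ladder.kappaInftyKappaInfty.hom (PLift ((0 : ℝ) ∈ Set.Ici 0))
      (PLift ((0 : ℝ) ∈ Set.Ici 0)) where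
  dom := AdaptedBasis.interval _ ⊤ fun _ t ht => by simpa using ht
  cod := AdaptedBasis.interval _ ⊤ fun _ t ht => by simpa using ht
  index i := i
  hom_basis _ := rfl

/-- Two ladders of modules generated at time `0` are isomorphic if they have adapted bases that
match, including the death times. -/
theorem nonempty_iso {F : Ladder.{u, v}} {G : Ladder.{u', v'}} {κ κ' μ μ' : Type*}
    (P : AdaptedPair F.hom κ κ') (Q : AdaptedPair G.hom μ μ')
    (hF : GeneratedAtZero F.dom) (hF' : GeneratedAtZero F.cod)
    (hG : GeneratedAtZero G.dom) (hG' : GeneratedAtZero G.cod)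
    (φ : μ ≃ κ) (ψ : μ' ≃ κ') (hφ : ∀ i, P.dom.death (φ i) = Q.dom.death i)
    (hψ : ∀ i, P.cod.death (ψ i) = Q.cod.death i)
    (hindex : ∀ i, P.index (φ i) = ψ (Q.index i)) : Nonempty (Ladder.Iso F G) := by
  obtain ⟨D, hD⟩ := P.dom.exists_iso Q.dom hF hG φ.symm fun i => by rw [← hφ]; simp
  obtain ⟨C, hC⟩ := P.cod.exists_iso Q.cod hF' hG' ψ.symm fun i => by rw [← hψ]; simp
  have hzero : ∀ x, P.cod.basis.equiv Q.cod.basis ψ.symm (F.hom.app 0 x) =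
      G.hom.app 0 (P.dom.basis.equiv Q.dom.basis φ.symm x) := by
    intro x
    refine LinearMap.congr_fun (f := (P.cod.basis.equiv Q.cod.basis ψ.symm).toLinearMap ∘ₗ
      F.hom.app 0) (g := G.hom.app 0 ∘ₗ (P.dom.basis.equiv Q.dom.basis φ.symm).toLinearMap)
      (P.dom.basis.ext fun i => ?_) x
    obtain ⟨j, rfl⟩ := φ.surjective i
    simp only [LinearMap.comp_apply, LinearEquiv.coe_coe, Module.Basis.equiv_apply, P.hom_basis,
      Q.hom_basis, hindex, Equiv.symm_apply_apply]
  refine ⟨⟨D, C, fun t x => ?_⟩⟩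
  by_cases ht : 0 ≤ t
  · obtain ⟨y, rfl⟩ := hF.surjective ht x
    rw [← F.hom.naturality, hC, hzero, hD, G.hom.naturality]
  · rw [hF.eq_zero_of_neg t (not_le.1 ht) x]
    simp

section BlockFunction

variable {V : PersistenceModule.{u}} {U : PersistenceModule.{v}} {f : Hom V U} {κ : Type w}
  {κ' : Type w'} (P : AdaptedPair f κ κ')

theorem index_injective (hf : Function.Injective (f.app 0)) : Function.Injective P.index :=
  fun i j h => P.dom.basis.injective (hf (by rw [P.hom_basis, P.hom_basis, h]))

theorem map_span_image (s : Set κ) :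
    (Submodule.span (ZMod 2) (P.dom.basis '' s)).map (f.app 0) =
      Submodule.span (ZMod 2) (P.cod.basis '' (P.index '' s)) := by
  rw [Submodule.map_span, Set.image_image, Set.image_image]
  simp only [P.hom_basis]

/-- The block function at `(a, b)` counts the basis vectors that die at time `a` in the domain,
and whose images die at time `b` in the codomain. -/
theorem blockFunction_eq [Finite κ'] (hf : Function.Injective (f.app 0))
    (a b : Set.Ioi (0 : ℝ)) :
    blockFunction f a b =
      {i | P.dom.death i = (a.1 : ℝ) ∧ P.cod.death (P.index i) = (b.1 : ℝ)}.ncard := by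
  unfold blockFunction
  rw [P.dom.kerPlus_eq_span, P.dom.kerMinus_eq_span, P.cod.kerPlus_eq_span,
    P.cod.kerMinus_eq_span, P.map_span_image, P.map_span_image, P.cod.basis.span_image_inf,
    P.cod.basis.span_image_inf, P.cod.basis.span_image_inf, ← Submodule.span_union,
    ← Set.image_union, P.cod.basis.finrank_span_image_quotient,
    ← Set.ncard_image_of_injective _ (P.index_injective hf)]
  · congr 1
    have hinj := P.index_injective hf
    ext k
    simp only [Set.mem_sdiff, Set.mem_inter_iff, Set.mem_image, Set.mem_ofPred_eq, Set.mem_union,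
      not_or, not_and, not_lt]
    constructor
    · rintro ⟨⟨⟨i, hi, rfl⟩, hb⟩, h1, h2⟩
      refine ⟨i, ⟨le_antisymm hi (not_lt.1 fun hlt => h1 ⟨i, hlt, rfl⟩ hb),
        le_antisymm hb (h2 ⟨i, hi, rfl⟩)⟩, rfl⟩
    · rintro ⟨i, ⟨ha, hb⟩, rfl⟩
      refine ⟨⟨⟨i, ha.le, rfl⟩, hb.le⟩, ?_, fun _ => hb.ge⟩
      rintro ⟨j, hj, hji⟩
      rw [hinj hji, ha] at hj
      exact (lt_irrefl _ hj).elim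
  · refine Set.union_subset (Set.inter_subset_inter_left _ (Set.image_mono ?_))
      (Set.inter_subset_inter_right _ ?_)
    · exact fun i (hi : P.dom.death i < _) => hi.le
    · exact fun i (hi : P.cod.death i < _) => hi.le

end BlockFunction

end AdaptedPair

end PersistenceModule

/-! ### Existence of adapted bases -/

namespace PersistenceModule

/-- A basis at time `0` is adapted if every structure map that kills a vector also kills all basis
vectors that occur in it. -/
def AdaptedBasis.ofBasis {V : PersistenceModule.{u}} {κ : Type w}
    (e : Module.Basis κ (ZMod 2) (V.space 0)) (d : κ → WithTop ℝ)
    (hd : ∀ {t : ℝ} (h : 0 ≤ t) (i : κ), V.map h (e i) = 0 ↔ d i ≤ (t : ℝ))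
    (he : ∀ {t : ℝ} (h : 0 ≤ t) (x : V.space 0), V.map h x = 0 →
      ∀ i, e.repr x i ≠ 0 → V.map h (e i) = 0) : AdaptedBasis V κ where
  basis := e
  death := d
  map_eq_zero_iff {t} h x := by
    constructor
    · intro hx i hi
      by_contra hne
      exact ((hd h i).1 (he h x hx i hne)).not_gt hi
    · intro hx
      have hmem : x ∈ Submodule.span (ZMod 2) (e '' {i | d i ≤ (t : ℝ)}) :=
        (e.mem_span_image_iff_repr _ _).2 fun i hi => hx i (not_le.1 hi)
      have hle : Submodule.span (ZMod 2) (e '' {i | d i ≤ (t : ℝ)}) ≤ LinearMap.ker (V.map h) := by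
        rw [Submodule.span_le]
        rintro _ ⟨i, hi, rfl⟩
        exact (hd h i).2 hi
      exact hle hmem

theorem isChain_ker_map (V : PersistenceModule.{u}) :
    IsChain (· ≤ ·) {F | ∃ (t : ℝ) (h : 0 ≤ t), F = LinearMap.ker (V.map h)} := by
  have key : ∀ {s t : ℝ} (hs : 0 ≤ s) (hst : s ≤ t),
      LinearMap.ker (V.map hs) ≤ LinearMap.ker (V.map (hs.trans hst)) := by
    intro s t hs hst x hx
    rw [LinearMap.mem_ker] at hx ⊢
    rw [← V.map_comp hs hst, hx, map_zero]
  rintro _ ⟨s, hs, rfl⟩ _ ⟨t, ht, rfl⟩ -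
  rcases le_total s t with h | h
  · exact Or.inl (key hs h)
  · exact Or.inr (key ht h)

/-- A morphism that is injective at time `0` has adapted bases: use a basis at time `0` of the
codomain that is adapted both to its own kernels and to the images of the kernels of the domain. -/
theorem AdaptedPair.exists_of_injective {V : PersistenceModule.{u}} {U : PersistenceModule.{v}}
    (f : Hom V U) [FiniteDimensional (ZMod 2) (U.space 0)] (hf : Function.Injective (f.app 0))
    (hV : ∀ x : V.space 0, ∃ d : WithTop ℝ, ∀ {t : ℝ} (h : 0 ≤ t), V.map h x = 0 ↔ d ≤ (t : ℝ))
    (hU : ∀ x : U.space 0, ∃ d : WithTop ℝ, ∀ {t : ℝ} (h : 0 ≤ t), U.map h x = 0 ↔ d ≤ (t : ℝ)) :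
    ∃ κ κ' : Type v, Finite κ' ∧ Nonempty (AdaptedPair f κ κ') := by
  choose dV hdV using hV
  choose dU hdU using hU
  have hchain : IsChain (· ≤ ·) (insert (LinearMap.range (f.app 0)) (Submodule.map (f.app 0) ''
      {F | ∃ (t : ℝ) (h : 0 ≤ t), F = LinearMap.ker (V.map h)})) := by
    refine IsChain.insert ?_ ?_
    · rintro _ ⟨F, hF, rfl⟩ _ ⟨G, hG, rfl⟩ -
      exact ((isChain_ker_map V).total hF hG).imp Submodule.map_mono Submodule.map_mono
    · rintro _ ⟨F, -, rfl⟩ -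
      exact Or.inr LinearMap.map_le_range
  obtain ⟨B, e, he⟩ := Submodule.exists_basis_adapted_to_chains hchain (isChain_ker_map U)
  -- the basis vectors in the image of the domain lift to a basis of the domain
  let S : Set B := {i | e i ∈ LinearMap.range (f.app 0)}
  have hlift : ∀ i : S, ∃ x, f.app 0 x = e i := fun i => i.2
  choose v hv using hlift
  have hcomp : f.app 0 ∘ v = e ∘ Subtype.val := funext hv
  have hind : LinearIndependent (ZMod 2) v := by
    refine LinearIndependent.of_comp (f.app 0) ?_
    rw [hcomp]
    exact e.linearIndependent.comp _ Subtype.val_injective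
  have hspan : ⊤ ≤ Submodule.span (ZMod 2) (Set.range v) := by
    intro x _
    have hx : f.app 0 x ∈ Submodule.span (ZMod 2) (e '' S) := by
      rw [e.mem_span_image_iff_repr]
      intro i hi
      by_contra hne
      exact hi (he _ (Or.inl (Set.mem_insert _ _)) _ ⟨x, rfl⟩ i hne)
    rw [Set.image_eq_range, show (fun i : S => e i) = f.app 0 ∘ v from hcomp.symm, Set.range_comp,
      ← Submodule.map_span] at hx
    obtain ⟨y, hy, hxy⟩ := hx
    exact hf hxy ▸ hy
  let e₀ : Module.Basis S (ZMod 2) (V.space 0) := Module.Basis.mk hind hspan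
  have he₀ : ∀ i, e₀ i = v i := fun i => Module.Basis.mk_apply _ _ i
  have hrepr : ∀ x (i : S), e.repr (f.app 0 x) i = e₀.repr x i := by
    intro x i
    have h1 : e.repr (f.app 0 x) = Finsupp.mapDomain Subtype.val (e₀.repr x) := by
      refine LinearMap.congr_fun (f := e.repr.toLinearMap ∘ₗ f.app 0)
        (g := Finsupp.lmapDomain _ _ Subtype.val ∘ₗ e₀.repr.toLinearMap) (e₀.ext fun j => ?_) x
      simp only [LinearMap.comp_apply, LinearEquiv.coe_coe, Finsupp.lmapDomain_apply,
        Module.Basis.repr_self, Finsupp.mapDomain_single]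
      rw [he₀, hv, e.repr_self]
    rw [h1, Finsupp.mapDomain_apply Subtype.val_injective]
  refine ⟨S, B, ?_, ⟨⟨AdaptedBasis.ofBasis e₀ (fun i => dV (e₀ i)) (fun h i => hdV _ h) ?_,
    AdaptedBasis.ofBasis e (fun i => dU (e i)) (fun h i => hdU _ h) ?_, Subtype.val, ?_⟩⟩⟩
  · exact Module.Finite.finite_basis e
  · intro t h x hx i hi
    rw [← hrepr] at hi
    obtain ⟨y, hy, hyi⟩ := he _ (Or.inl (Set.mem_insert_of_mem _ ⟨_, ⟨t, h, rfl⟩, rfl⟩)) _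
      ⟨x, hx, rfl⟩ i hi
    have : y = e₀ i := hf (by rw [hyi, he₀, hv])
    exact this ▸ hy
  · intro t h x hx i hi
    exact he _ (Or.inr ⟨t, h, rfl⟩) x hx i hi
  · intro i
    change f.app 0 (e₀ i) = e i
    rw [he₀, hv]

/-- Naturality: the image of a class that is zero at time `t` is zero at time `t`. -/
theorem AdaptedPair.death_index_le {V : PersistenceModule.{u}} {U : PersistenceModule.{v}}
    {f : Hom V U} {κ : Type w} {κ' : Type w'} (P : AdaptedPair f κ κ') (i : κ) :
    P.cod.death (P.index i) ≤ P.dom.death i := by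
  have hpos := P.dom.death_pos i
  cases h : P.dom.death i with
  | top => exact le_top
  | coe r =>
    rw [h] at hpos
    have hr : 0 ≤ r := (WithTop.coe_lt_coe.1 hpos).le
    rw [← P.cod.basis_mem_ker hr, ← P.hom_basis, f.naturality,
      (P.dom.basis_mem_ker hr i).2 h.le, map_zero]

end PersistenceModule

/-! ### The Vietoris-Rips filtration -/

namespace VietorisRips

open PersistenceModule

variable {X : Type u} {Z : Type v} [MetricSpace X] [MetricSpace Z]

theorem generatedAtZero_PH0 (X : Type u) [MetricSpace X] : GeneratedAtZero (PH0 X) where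
  eq_zero_of_neg t ht x := by
    have : IsEmpty (Components X t) :=
      ⟨fun c => c.ind fun x => ht.not_ge x.2⟩
    exact Subsingleton.elim (α := Components X t →₀ ZMod 2) _ _
  surjective {t} h := by
    refine Finsupp.mapDomain_surjective fun c => ?_
    induction c using SimpleGraph.ConnectedComponent.ind with
    | _ x => exact ⟨(graph X 0).connectedComponentMk ⟨x.1, le_rfl⟩, rfl⟩

/-- The graphs `VR_s(X)` and `VR_t(X)` have the same components if no distance lies in `(s, t]`. -/
theorem map_injective {s t : ℝ} (hst : s ≤ t) (h : ∀ x y : X, dist x y ≤ t → dist x y ≤ s) :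
    Function.Injective ((PH0 X).map hst) := by
  refine Finsupp.mapDomain_injective fun c c' hc => ?_
  induction c using SimpleGraph.ConnectedComponent.ind with
  | _ x =>
  induction c' using SimpleGraph.ConnectedComponent.ind with
  | _ y =>
  have hr := SimpleGraph.ConnectedComponent.exact hc
  let φ : graph X t →g graph X s :=
    ⟨fun z => ⟨z.1, x.2⟩, fun {a b} hab =>
      ⟨fun h' => hab.1 (Subtype.ext (Subtype.mk.inj h')), h _ _ hab.2⟩⟩
  exact SimpleGraph.ConnectedComponent.sound (hr.map φ)

/-- The kernels of the structure maps only jump at the finitely many distances, so every class at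
time `0` has a first time at which it is zero, unless it never dies. -/
theorem exists_death [Finite X] (x : (PH0 X).space 0) :
    ∃ d : WithTop ℝ, ∀ {t : ℝ} (h : 0 ≤ t), (PH0 X).map h x = 0 ↔ d ≤ (t : ℝ) := by
  let D : Set ℝ := insert 0 (Set.range fun p : X × X => dist p.1 p.2)
  have hD : D.Finite := (Set.finite_range _).insert 0
  have hD0 : ∀ s ∈ D, 0 ≤ s := by
    rintro s (rfl | ⟨p, rfl⟩)
    · exact le_rfl
    · exact dist_nonneg
  have hmono : ∀ {s t : ℝ} (hs : 0 ≤ s) (hst : s ≤ t), (PH0 X).map hs x = 0 →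
      (PH0 X).map (hs.trans hst) x = 0 := by
    intro s t hs hst hx
    rw [← (PH0 X).map_comp hs hst, hx, map_zero]
  -- a class that is zero at time `t` is zero at the largest element of `D` that is at most `t`
  have hround : ∀ {t : ℝ} (h : 0 ≤ t), (PH0 X).map h x = 0 →
      ∃ s, ∃ hs : s ∈ D, s ≤ t ∧ (PH0 X).map (hD0 s hs) x = 0 := by
    intro t h hx
    obtain ⟨s, ⟨hs, hst⟩, hmax⟩ := Set.exists_max_image (D ∩ Set.Iic t) id
      (hD.inter_of_left _) ⟨0, Set.mem_insert _ _, h⟩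
    replace hst : s ≤ t := hst
    refine ⟨s, hs, hst, map_injective (X := X) hst (fun y z hyz => ?_) ?_⟩
    · exact hmax _ ⟨Set.mem_insert_of_mem _ ⟨(y, z), rfl⟩, hyz⟩
    · rw [(PH0 X).map_comp, hx, map_zero]
  by_cases hne : ∃ s, ∃ hs : s ∈ D, (PH0 X).map (hD0 s hs) x = 0
  · obtain ⟨s, ⟨hs, hsx⟩, hmin⟩ := Set.exists_min_image
      {s | ∃ hs : s ∈ D, (PH0 X).map (hD0 s hs) x = 0} id
      (hD.subset fun s hs => hs.1) hne
    refine ⟨(s : ℝ), fun {t} h => ⟨fun hx => ?_, fun hst => ?_⟩⟩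
    · obtain ⟨r, hr, hrt, hrx⟩ := hround h hx
      exact WithTop.coe_le_coe.2 ((hmin r ⟨hr, hrx⟩).trans hrt)
    · exact hmono (hD0 s hs) (WithTop.coe_le_coe.1 hst) hsx
  · refine ⟨⊤, fun {t} h => ⟨fun hx => ?_, fun hst => ?_⟩⟩
    · obtain ⟨r, hr, hrt, hrx⟩ := hround h hx
      exact (hne ⟨r, hr, hrx⟩).elim
    · simp at hst

theorem componentsMap_zero_injective {g : X → Z} (hg : ∀ x y, dist (g x) (g y) ≤ dist x y)
    (hinj : Function.Injective g) : Function.Injective (componentsMap g hg (le_refl (0 : ℝ))) := by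
  intro c c' hc
  induction c using SimpleGraph.ConnectedComponent.ind with
  | _ x =>
  induction c' using SimpleGraph.ConnectedComponent.ind with
  | _ y =>
  -- there are no edges at time `0`
  have hbot : graph Z 0 = ⊥ := by
    ext a b
    simp only [graph, SimpleGraph.bot_adj, iff_false, not_and, not_le, dist_pos]
    exact fun h h' => h (Subtype.ext h')
  have hr := SimpleGraph.ConnectedComponent.exact hc
  rw [hbot, SimpleGraph.reachable_bot] at hr
  exact congrArg _ (Subtype.ext (hinj (congrArg Subtype.val hr)))

theorem PH0Map_zero_injective {g : X → Z} (hg : ∀ x y, dist (g x) (g y) ≤ dist x y)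
    (hinj : Function.Injective g) : Function.Injective ((PH0Map g hg).app 0) :=
  Finsupp.mapDomain_injective (componentsMap_zero_injective hg hinj)

theorem exists_adaptedPair [Finite Z] [Finite X] {g : X → Z}
    (hg : ∀ x y, dist (g x) (g y) ≤ dist x y) (hinj : Function.Injective g) :
    ∃ κ κ' : Type v, Finite κ' ∧ Nonempty (AdaptedPair (PH0Map g hg) κ κ') := by
  have : Finite (Components Z 0) := Quot.finite _
  have : FiniteDimensional (ZMod 2) ((PH0 Z).space 0) :=
    inferInstanceAs (FiniteDimensional (ZMod 2) (Components Z 0 →₀ ZMod 2))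
  exact AdaptedPair.exists_of_injective _ (PH0Map_zero_injective hg hinj) exists_death exists_death

theorem exists_dist_le (X : Type u) [MetricSpace X] [Finite X] :
    ∃ t : ℝ, 0 ≤ t ∧ ∀ x y : X, dist x y ≤ t := by
  obtain ⟨t, ht⟩ := (Set.finite_range fun p : X × X => dist p.1 p.2).bddAbove
  exact ⟨max t 0, le_max_right _ _, fun x y => (ht ⟨(x, y), rfl⟩).trans (le_max_left _ _)⟩

theorem subsingleton_components {t : ℝ} (ht : ∀ x y : X, dist x y ≤ t) :
    Subsingleton (Components X t) := by
  refine ⟨fun c c' => ?_⟩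
  induction c using SimpleGraph.ConnectedComponent.ind with
  | _ x =>
  induction c' using SimpleGraph.ConnectedComponent.ind with
  | _ y =>
  by_cases h : x = y
  · rw [h]
  · exact SimpleGraph.ConnectedComponent.sound (SimpleGraph.Adj.reachable ⟨h, ht _ _⟩)

/-- Once the graph is complete, exactly the classes that never die are still non-zero. -/
theorem death_eq_top_iff {κ : Type w} (A : AdaptedBasis (PH0 X) κ) {t : ℝ} (h : 0 ≤ t)
    (ht : ∀ x y : X, dist x y ≤ t) (i : κ) :
    A.death i = ⊤ ↔ (PH0 X).map h (A.basis i) ≠ 0 := by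
  rw [Ne, A.basis_mem_ker]
  refine ⟨fun hi => by simp [hi], fun hi => ?_⟩
  by_contra hne
  obtain ⟨r, hr⟩ := WithTop.ne_top_iff_exists.1 hne
  rw [← hr, not_le, WithTop.coe_lt_coe] at hi
  have h1 := (A.basis_mem_ker (h.trans hi.le) i).2 hr.ge
  rw [← (PH0 X).map_comp h hi.le] at h1
  have h2 := map_injective (X := X) hi.le (fun x y _ => ht x y) (h1.trans (map_zero _).symm)
  rw [A.basis_mem_ker, ← hr, WithTop.coe_le_coe] at h2
  exact h2.not_gt hi

/-- Exactly one basis vector never dies. For the uniqueness, two of them would have the same image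
in the one-dimensional space at a late time, so their difference would die. -/
theorem existsUnique_death_eq_top [Finite X] [Nonempty X] {κ : Type w}
    (A : AdaptedBasis (PH0 X) κ) : ∃! i, A.death i = ⊤ := by
  obtain ⟨t, h, ht⟩ := exists_dist_le X
  have hsub := subsingleton_components ht
  simp only [death_eq_top_iff A h ht]
  refine existsUnique_of_exists_of_unique ?_ ?_
  · by_contra! hzero
    have h0 : (PH0 X).map h = 0 := A.basis.ext fun i => by simpa using hzero i
    let c : Components X t := (graph X t).connectedComponentMk ⟨Classical.arbitrary X, h⟩
    obtain ⟨y, hy⟩ := (generatedAtZero_PH0 X).surjective h (Finsupp.single c 1)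
    rw [h0, LinearMap.zero_apply] at hy
    exact one_ne_zero (Finsupp.single_eq_zero.1 hy.symm)
  · intro i j hi hj
    have huniq : ∀ a b : Components X t →₀ ZMod 2, a ≠ 0 → b ≠ 0 → a = b := by
      intro a b ha hb
      ext c
      obtain ⟨c₁, hc₁⟩ := Finsupp.ne_iff.1 ha
      obtain ⟨c₂, hc₂⟩ := Finsupp.ne_iff.1 hb
      rw [Subsingleton.elim c₁ c, Finsupp.zero_apply] at hc₁
      rw [Subsingleton.elim c₂ c, Finsupp.zero_apply] at hc₂
      have : ∀ p q : ZMod 2, p ≠ 0 → q ≠ 0 → p = q := by decide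
      exact this _ _ hc₁ hc₂
    by_contra hij
    have h0 : (PH0 X).map h (A.basis i - A.basis j) = 0 := by
      rw [map_sub, sub_eq_zero]
      exact huniq _ _ hi hj
    rw [A.map_eq_zero_iff] at h0
    have hlt : (t : WithTop ℝ) < A.death i := by
      rw [(death_eq_top_iff A h ht i).2 hi]
      exact WithTop.coe_lt_top t
    simpa [Finsupp.single_apply, Ne.symm hij, hij] using h0 i hlt

/-- A class that never dies is still non-zero at a time at which both graphs are complete, and the
morphism is injective there. -/
theorem death_index_eq_top_iff [Finite X] [Finite Z] {g : X → Z}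
    {hg : ∀ x y, dist (g x) (g y) ≤ dist x y} {κ : Type w} {κ' : Type w'}
    (P : AdaptedPair (PH0Map g hg) κ κ') (i : κ) :
    P.cod.death (P.index i) = ⊤ ↔ P.dom.death i = ⊤ := by
  obtain ⟨s, hs, hs'⟩ := exists_dist_le X
  obtain ⟨t, ht, ht'⟩ := exists_dist_le Z
  have h : 0 ≤ max s t := hs.trans (le_max_left _ _)
  have hX : ∀ x y : X, dist x y ≤ max s t := fun x y => (hs' x y).trans (le_max_left _ _)
  have hsub := subsingleton_components hX
  have hinj : Function.Injective ((PH0Map g hg).app (max s t)) :=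
    Finsupp.mapDomain_injective (Function.injective_of_subsingleton _)
  rw [death_eq_top_iff P.dom h hX,
    death_eq_top_iff P.cod h fun x y => (ht' x y).trans (le_max_right _ _), ← P.hom_basis,
    (PH0Map g hg).naturality, Ne, Ne, map_eq_zero_iff _ hinj]

end VietorisRips

/-! ### Barcodes -/

namespace PersistenceModule

theorem AdaptedBasis.exists_death_eq {V : PersistenceModule.{u}} {κ : Type w}
    (A : AdaptedBasis V κ) {i : κ} (hi : A.death i ≠ ⊤) :
    ∃ b : Set.Ioi (0 : ℝ), A.death i = (b.1 : ℝ) := by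
  obtain ⟨r, hr⟩ := WithTop.ne_top_iff_exists.1 hi
  have := A.death_pos i
  rw [← hr] at this
  exact ⟨⟨r, WithTop.coe_lt_coe.1 this⟩, hr.symm⟩

/-- The adapted basis of a direct sum of interval modules that is given by the intervals which
contain `0`. -/
def AdaptedBasis.ofMultiplicities (m : BoundedInterval → ℕ) :
    AdaptedBasis (PersistenceModule.prod
      (PersistenceModule.directSum fun j : (J : BoundedInterval) × Fin (m J) =>
        PersistenceModule.interval (Set.Ico j.1.1.1 j.1.1.2)) kappaInfty)
      ((Σ j : (J : BoundedInterval) × Fin (m J), PLift ((0 : ℝ) ∈ Set.Ico j.1.1.1 j.1.1.2)) ⊕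
        PLift ((0 : ℝ) ∈ Set.Ici 0)) :=
  (AdaptedBasis.directSum fun j : (J : BoundedInterval) × Fin (m J) =>
    AdaptedBasis.interval (Set.Ico j.1.1.1 j.1.1.2) (j.1.1.2 : ℝ) fun h t ht => by
      simp [h.1.trans ht]).prod
    (AdaptedBasis.interval _ ⊤ fun _ t ht => by simpa using ht)

/-- An adapted basis with exactly one class that never dies yields a barcode. -/
theorem AdaptedBasis.isBarcode {U : PersistenceModule.{u}} {κ : Type w} [Finite κ]
    (A : AdaptedBasis U κ) (hU : GeneratedAtZero U) (htop : ∃! k, A.death k = ⊤) :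
    IsBarcode U fun J => Nat.card {k // J.1.1 = 0 ∧ A.death k = (J.1.2 : ℝ)} := by
  obtain ⟨k₀, hk₀, huniq⟩ := htop
  let m : BoundedInterval → ℕ := fun J => Nat.card {k // J.1.1 = 0 ∧ A.death k = (J.1.2 : ℝ)}
  let σ : ∀ J : BoundedInterval, Fin (m J) ≃ {k // J.1.1 = 0 ∧ A.death k = (J.1.2 : ℝ)} :=
    fun J => (Finite.equivFin _).symm
  let ψ : ((Σ j : (J : BoundedInterval) × Fin (m J), PLift ((0 : ℝ) ∈ Set.Ico j.1.1.1 j.1.1.2)) ⊕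
      PLift ((0 : ℝ) ∈ Set.Ici 0)) → κ :=
    Sum.elim (fun x => (σ x.1.1 x.1.2).1) fun _ => k₀
  have hψ : ∀ x, A.death (ψ x) = (AdaptedBasis.ofMultiplicities m).death x := by
    rintro (⟨⟨J, n⟩, h⟩ | h)
    · exact (σ J n).2.2
    · exact hk₀
  have hbij : Function.Bijective ψ := by
    constructor
    · rintro (⟨⟨J, n⟩, ⟨h⟩⟩ | h) (⟨⟨J', n'⟩, ⟨h'⟩⟩ | h') heq
      · have h1 := hψ (Sum.inl ⟨⟨J, n⟩, ⟨h⟩⟩)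
        rw [heq, hψ] at h1
        have h2 : J = J' := Subtype.ext (Prod.ext ((σ J n).2.1.trans (σ J' n').2.1.symm)
          (WithTop.coe_injective h1.symm))
        subst h2
        have h3 : n = n' := (σ J).injective (Subtype.ext heq)
        subst h3
        rfl
      · have h1 := hψ (Sum.inl ⟨⟨J, n⟩, ⟨h⟩⟩)
        rw [heq, hψ] at h1
        exact (WithTop.top_ne_coe h1).elim
      · have h1 := hψ (Sum.inl ⟨⟨J', n'⟩, ⟨h'⟩⟩)
        rw [← heq, hψ] at h1
        exact (WithTop.top_ne_coe h1).elim
      · exact congrArg Sum.inr (Subsingleton.elim h h')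
    · intro k
      by_cases hk : A.death k = ⊤
      · exact ⟨Sum.inr ⟨Set.mem_Ici.2 le_rfl⟩, (huniq k hk).symm⟩
      · obtain ⟨b, hb⟩ := A.exists_death_eq hk
        let J : BoundedInterval := ⟨(0, b.1), b.2⟩
        refine ⟨Sum.inl ⟨⟨J, (σ J).symm ⟨k, rfl, hb⟩⟩, ⟨le_rfl, b.2⟩⟩, ?_⟩
        simp [ψ]
  have hgen : GeneratedAtZero (PersistenceModule.prod
      (PersistenceModule.directSum fun j : (J : BoundedInterval) × Fin (m J) =>
        PersistenceModule.interval (Set.Ico j.1.1.1 j.1.1.2)) kappaInfty) := by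
    refine (GeneratedAtZero.directSum fun j => ?_).prod
      (GeneratedAtZero.interval (Set.mem_Ici.2 le_rfl) fun t ht => ht)
    have h0 : j.1.1.1 = 0 := (σ j.1 j.2).2.1
    refine GeneratedAtZero.interval ⟨h0.le, ?_⟩ fun t ht => h0.ge.trans ht.1
    exact h0 ▸ j.1.2
  obtain ⟨E, -⟩ := A.exists_iso (AdaptedBasis.ofMultiplicities m) hU hgen
    (Equiv.ofBijective ψ hbij).symm fun k => by
      rw [← hψ]
      exact congrArg A.death ((Equiv.ofBijective ψ hbij).apply_symm_apply k)
  exact ⟨E⟩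

/-- The multiplicity of `[0, b)` in any barcode is the number of basis vectors that die at time
`b`. Since the module vanishes before time `0`, no interval starts earlier. -/
theorem IsBarcode.apply_eq {U : PersistenceModule.{u}} {m : BoundedInterval → ℕ}
    (hm : IsBarcode U m) {κ : Type w} [Finite κ] (A : AdaptedBasis U κ) (hU : GeneratedAtZero U)
    (b : Set.Ioi (0 : ℝ)) : m ⟨(0, b.1), b.2⟩ = {k | A.death k = (b.1 : ℝ)}.ncard := by
  obtain ⟨E⟩ := hm
  let B := (AdaptedBasis.ofMultiplicities m).ofIso E
  have := A.basis.finiteDimensional_of_finite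
  have := Module.Finite.finite_basis B.basis
  let J₀ : BoundedInterval := ⟨(0, b.1), b.2⟩
  let ν : Fin (m J₀) →
      ((Σ j : (J : BoundedInterval) × Fin (m J), PLift ((0 : ℝ) ∈ Set.Ico j.1.1.1 j.1.1.2)) ⊕
        PLift ((0 : ℝ) ∈ Set.Ici 0)) := fun n => Sum.inl ⟨⟨J₀, n⟩, ⟨le_rfl, b.2⟩⟩
  have hν : Function.Injective ν := by
    intro n n' h
    simpa [ν] using h
  have hrange : {x | B.death x = (b.1 : ℝ)} = Set.range ν := by
    ext x
    constructor
    · intro hx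
      rcases x with ⟨⟨⟨⟨p, q⟩, hpq⟩, n⟩, ⟨h⟩⟩ | h
      · have hq : q = b.1 := WithTop.coe_injective hx
        have hp : p = 0 := by
          -- otherwise the summand of `[p, b)` contributes a non-zero class at the negative time `p`
          by_contra hne
          have hneg : p < 0 := lt_of_le_of_ne h.1 hne
          let j : (J : BoundedInterval) × Fin (m J) := ⟨⟨(p, q), hpq⟩, n⟩
          classical
          let y : DirectSum ((J : BoundedInterval) × Fin (m J)) fun j =>
              (PersistenceModule.interval (Set.Ico j.1.1.1 j.1.1.2)).space p :=
            DirectSum.of (fun j : (J : BoundedInterval) × Fin (m J) =>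
              (PersistenceModule.interval (Set.Ico j.1.1.1 j.1.1.2)).space p) j
              (⟨1, fun h => (h ⟨le_rfl, hpq⟩).elim⟩ : intervalSpace (Set.Ico p q) p)
          have hy : y = 0 := by
            obtain ⟨x, hx⟩ := (E.app p).surjective (y, 0)
            rw [hU.eq_zero_of_neg p hneg x, map_zero] at hx
            exact (congrArg Prod.fst hx).symm
          have h1 := DirectSum.of_injective (β := fun j : (J : BoundedInterval) × Fin (m J) =>
              (PersistenceModule.interval (Set.Ico j.1.1.1 j.1.1.2)).space p) j
              (hy.trans (map_zero _).symm)
          exact one_ne_zero (congrArg Subtype.val h1)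
        subst hp hq
        exact ⟨n, rfl⟩
      · exact (WithTop.top_ne_coe hx).elim
    · rintro ⟨n, rfl⟩
      rfl
  rw [A.ncard_death_eq, ← B.ncard_death_eq, hrange, ← Set.image_univ,
    Set.ncard_image_of_injective _ hν, Set.ncard_univ, Nat.card_fin]

/-! ### Multiplicities and the decomposition of ladders -/

namespace AdaptedPair

theorem finite_support_blockFunction {V : PersistenceModule.{u}} {U : PersistenceModule.{v}}
    {f : Hom V U} {κ : Type w} {κ' : Type w'} [Finite κ] [Finite κ'] (P : AdaptedPair f κ κ')
    (hf : Function.Injective (f.app 0)) (b : Set.Ioi (0 : ℝ)) :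
    {a | blockFunction f a b ≠ 0}.Finite := by
  refine Set.Finite.of_finite_image (f := fun a : Set.Ioi (0 : ℝ) => ((a.1 : ℝ) : WithTop ℝ))
    ((Set.finite_range P.dom.death).subset ?_)
    fun a _ a' _ h => Subtype.ext (WithTop.coe_injective h)
  rintro _ ⟨a, ha, rfl⟩
  rw [Set.mem_ofPred_eq, P.blockFunction_eq hf] at ha
  obtain ⟨i, hi⟩ := Set.nonempty_of_ncard_ne_zero ha
  exact ⟨i, hi.1⟩

section

variable {V : PersistenceModule.{u}} {U : PersistenceModule.{v}} {f : Hom V U} {κ : Type w}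
  {κ' : Type w'} (P : AdaptedPair f κ κ')

/-- The sum of the block function over `a` counts the basis vectors whose images die at `b`. -/
theorem finsum_blockFunction [Finite κ] [Finite κ'] (hf : Function.Injective (f.app 0))
    (htop : ∀ i, P.dom.death i = ⊤ → P.cod.death (P.index i) = ⊤) (b : Set.Ioi (0 : ℝ)) :
    ∑ᶠ a : Set.Ioi (0 : ℝ), (blockFunction f a b : ℤ) =
      {i | P.cod.death (P.index i) = (b.1 : ℝ)}.ncard := by
  classical
  have := Fintype.ofFinite κ
  have hex : ∀ i, ∃ a : Set.Ioi (0 : ℝ), P.cod.death (P.index i) = (b.1 : ℝ) →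
      P.dom.death i = (a.1 : ℝ) := by
    intro i
    by_cases hi : P.cod.death (P.index i) = (b.1 : ℝ)
    · obtain ⟨a, ha⟩ := P.dom.exists_death_eq (i := i) fun h =>
        WithTop.top_ne_coe ((htop i h).symm.trans hi)
      exact ⟨a, fun _ => ha⟩
    · exact ⟨b, fun h => (hi h).elim⟩
  -- `δ i` is the death time of `i` in the domain, and has a dummy value if `i` does not count
  choose δ hδ using hex
  have hblock : ∀ a, blockFunction f a b =
      (Finset.univ.filter fun i => P.cod.death (P.index i) = (b.1 : ℝ) ∧ δ i = a).card := by
    intro a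
    rw [P.blockFunction_eq hf, ← Set.ncard_coe_finset]
    congr 1
    ext i
    simp only [Finset.coe_filter, Finset.mem_univ, true_and, Set.mem_ofPred_eq]
    constructor
    · rintro ⟨ha, hb⟩
      exact ⟨hb, Subtype.ext (WithTop.coe_injective ((hδ i hb).symm.trans ha))⟩
    · rintro ⟨hb, rfl⟩
      exact ⟨hδ i hb, hb⟩
  have hcard : {i | P.cod.death (P.index i) = (b.1 : ℝ)}.ncard =
      (Finset.univ.filter fun i => P.cod.death (P.index i) = (b.1 : ℝ)).card := by
    rw [← Set.ncard_coe_finset]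
    congr 1
    ext i
    simp
  rw [hcard, finsum_eq_sum_of_support_subset (s := Finset.univ.image δ)]
  · rw [Finset.card_eq_sum_card_fiberwise (f := δ) (t := Finset.univ.image δ)
      fun i _ => by simp]
    push_cast
    refine Finset.sum_congr rfl fun a _ => ?_
    rw [hblock, Finset.filter_filter]
  · intro a ha
    rw [Function.mem_support, hblock, Nat.cast_ne_zero, Finset.card_ne_zero] at ha
    obtain ⟨i, hi⟩ := ha
    simp only [Finset.mem_filter] at hi
    simpa using ⟨i, hi.2.2⟩

/-- The unmatched multiplicity at `b` counts the basis vectors outside the image of the morphism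
that die at time `b`. -/
theorem unmatched_eq [Finite κ] [Finite κ'] (hf : Function.Injective (f.app 0))
    (htop : ∀ i, P.dom.death i = ⊤ → P.cod.death (P.index i) = ⊤) (hU : GeneratedAtZero U)
    {m : BoundedInterval → ℕ} (hm : IsBarcode U m) (b : Set.Ioi (0 : ℝ)) :
    unmatched f m b = {k | P.cod.death k = (b.1 : ℝ) ∧ k ∉ Set.range P.index}.ncard := by
  unfold unmatched
  have himage : {i | P.cod.death (P.index i) = (b.1 : ℝ)}.ncard =
      ({k | P.cod.death k = (b.1 : ℝ)} ∩ Set.range P.index).ncard := by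
    rw [← Set.ncard_image_of_injective _ (P.index_injective hf)]
    congr 1
    ext k
    constructor
    · rintro ⟨i, hi, rfl⟩
      exact ⟨hi, i, rfl⟩
    · rintro ⟨hk, i, rfl⟩
      exact ⟨i, hk, rfl⟩
  rw [P.finsum_blockFunction hf htop, hm.apply_eq P.cod hU, himage,
    ← Set.ncard_inter_add_ncard_sdiff_eq_ncard {k | P.cod.death k = (b.1 : ℝ)} (Set.range P.index)]
  push_cast
  rw [add_sub_cancel_left]
  rfl

end

/-- A ladder of modules generated at time `0` that has adapted bases with exactly one class that
never dies, a class of the domain, is the sum of the ladders `κ_a → κ_b` and `0 → κ_b`, with the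
multiplicities given by the numbers of basis vectors, and of `κ_∞ → κ_∞`. -/
theorem nonempty_iso_sum {F : Ladder.{u, v}} {κ : Type w} {κ' : Type w'} [Finite κ] [Finite κ']
    (P : AdaptedPair F.hom κ κ') (hF : GeneratedAtZero F.dom) (hF' : GeneratedAtZero F.cod)
    (hindex : Function.Injective P.index) (i₀ : κ) (hdom : ∀ i, P.dom.death i = ⊤ ↔ i = i₀)
    (hcod : ∀ k, P.cod.death k = ⊤ ↔ k = P.index i₀)
    (M : Set.Ioi (0 : ℝ) → Set.Ioi (0 : ℝ) → ℕ) (N : Set.Ioi (0 : ℝ) → ℕ)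
    (hM : ∀ a b, M a b =
      {i | P.dom.death i = (a.1 : ℝ) ∧ P.cod.death (P.index i) = (b.1 : ℝ)}.ncard)
    (hN : ∀ b, N b = {k | P.cod.death k = (b.1 : ℝ) ∧ k ∉ Set.range P.index}.ncard) :
    Nonempty (Ladder.Iso F (Ladder.prod (Ladder.prod
      (Ladder.directSum fun i : (b : Set.Ioi (0 : ℝ)) × (a : {a : Set.Ioi (0 : ℝ) // b ≤ a}) ×
        Fin (M a b) => Ladder.kappaKappa i.2.1.2)
      (Ladder.directSum fun i : (b : Set.Ioi (0 : ℝ)) × Fin (N b) => Ladder.zeroKappa i.1))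
      Ladder.kappaInftyKappaInfty)) := by
  let Q := ((AdaptedPair.directSum fun i : (b : Set.Ioi (0 : ℝ)) ×
      (a : {a : Set.Ioi (0 : ℝ) // b ≤ a}) × Fin (M a b) => kappaKappa i.2.1.2).prod
    (AdaptedPair.directSum fun i : (b : Set.Ioi (0 : ℝ)) × Fin (N b) => zeroKappa.{0} i.1)).prod
    kappaInftyKappaInfty
  -- `σ` and `τ` number the basis vectors of each type, which gives bijections `φ` and `ψ` from the
  -- index types of the adapted bases of the sum to those of `P`
  let σ : ∀ a b, Fin (M a b) ≃
      {i | P.dom.death i = (a.1 : ℝ) ∧ P.cod.death (P.index i) = (b.1 : ℝ)} := fun a b =>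
    (Finite.equivFinOfCardEq ((Nat.card_coe_set_eq _).trans (hM a b).symm)).symm
  let τ : ∀ b, Fin (N b) ≃ {k | P.cod.death k = (b.1 : ℝ) ∧ k ∉ Set.range P.index} := fun b =>
    (Finite.equivFinOfCardEq ((Nat.card_coe_set_eq _).trans (hN b).symm)).symm
  let φ : ((Σ i : (b : Set.Ioi (0 : ℝ)) × (a : {a : Set.Ioi (0 : ℝ) // b ≤ a}) × Fin (M a b),
        PLift ((0 : ℝ) ∈ Set.Ico 0 i.2.1.1.1)) ⊕
      (Σ _ : (b : Set.Ioi (0 : ℝ)) × Fin (N b), PEmpty.{1})) ⊕ PLift ((0 : ℝ) ∈ Set.Ici 0) → κ :=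
    Sum.elim (Sum.elim (fun x => (σ x.1.2.1 x.1.1 x.1.2.2).1) fun x => x.2.elim) fun _ => i₀
  let ψ : ((Σ i : (b : Set.Ioi (0 : ℝ)) × (a : {a : Set.Ioi (0 : ℝ) // b ≤ a}) × Fin (M a b),
        PLift ((0 : ℝ) ∈ Set.Ico 0 i.1.1)) ⊕
      (Σ i : (b : Set.Ioi (0 : ℝ)) × Fin (N b), PLift ((0 : ℝ) ∈ Set.Ico 0 i.1.1))) ⊕
      PLift ((0 : ℝ) ∈ Set.Ici 0) → κ' :=
    Sum.elim (Sum.elim (fun x => P.index (σ x.1.2.1 x.1.1 x.1.2.2).1) fun x => (τ x.1.1 x.1.2).1)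
      fun _ => P.index i₀
  have hφdeath : ∀ x, P.dom.death (φ x) = Q.dom.death x := by
    rintro ((⟨⟨b, a, n⟩, h⟩ | x) | h)
    · exact (σ a b n).2.1
    · exact x.2.elim
    · exact (hdom i₀).2 rfl
  have hψdeath : ∀ x, P.cod.death (ψ x) = Q.cod.death x := by
    rintro ((⟨⟨b, a, n⟩, h⟩ | ⟨⟨b, n⟩, h⟩) | h)
    · exact (σ a b n).2.2
    · exact (τ b n).2.1
    · exact (hcod _).2 rfl
  have hcomm : ∀ x, P.index (φ x) = ψ (Q.index x) := by
    rintro ((⟨⟨b, a, n⟩, h⟩ | x) | h)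
    · rfl
    · exact x.2.elim
    · rfl
  have hσ : ∀ {a b a' b' : Set.Ioi (0 : ℝ)} {n : Fin (M a b)} {n' : Fin (M a' b')},
      (σ a b n).1 = (σ a' b' n').1 → a = a' ∧ b = b' := by
    intro a b a' b' n n' h
    have h1 := (σ a b n).2
    have h2 := (σ a' b' n').2
    rw [h] at h1
    exact ⟨Subtype.ext (WithTop.coe_injective (h1.1.symm.trans h2.1)),
      Subtype.ext (WithTop.coe_injective (h1.2.symm.trans h2.2))⟩
  have hσ₀ : ∀ {a b : Set.Ioi (0 : ℝ)} (n : Fin (M a b)), (σ a b n).1 ≠ i₀ := fun {a b} n h =>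
    WithTop.top_ne_coe (((hdom _).2 h).symm.trans (σ a b n).2.1)
  have hφ : Function.Bijective φ := by
    constructor
    · rintro ((⟨⟨b, ⟨a, hab⟩, n⟩, ⟨h⟩⟩ | x) | h)
        ((⟨⟨b', ⟨a', hab'⟩, n'⟩, ⟨h'⟩⟩ | x') | h') heq
      · obtain ⟨rfl, rfl⟩ := hσ heq
        obtain rfl := (σ a b).injective (Subtype.ext heq)
        rfl
      · exact x'.2.elim
      · exact (hσ₀ n heq).elim
      · exact x.2.elim
      · exact x.2.elim
      · exact x.2.elim
      · exact (hσ₀ n' heq.symm).elim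
      · exact x'.2.elim
      · exact congrArg Sum.inr (Subsingleton.elim h h')
    · intro i
      by_cases hi : i = i₀
      · exact ⟨Sum.inr ⟨Set.mem_Ici.2 le_rfl⟩, hi.symm⟩
      · obtain ⟨a, ha⟩ := P.dom.exists_death_eq fun h => hi ((hdom i).1 h)
        obtain ⟨b, hb⟩ := P.cod.exists_death_eq (i := P.index i) fun h =>
          hi (hindex ((hcod _).1 h))
        have hab : b ≤ a := by
          have := P.death_index_le i
          rw [ha, hb, WithTop.coe_le_coe] at this
          exact this
        refine ⟨Sum.inl (Sum.inl ⟨⟨b, ⟨a, hab⟩, (σ a b).symm ⟨i, ha, hb⟩⟩, ⟨le_rfl, a.2⟩⟩), ?_⟩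
        simp [φ]
  have hψ : Function.Bijective ψ := by
    constructor
    · rintro ((⟨⟨b, ⟨a, hab⟩, n⟩, ⟨h⟩⟩ | ⟨⟨b, n⟩, ⟨h⟩⟩) | h)
        ((⟨⟨b', ⟨a', hab'⟩, n'⟩, ⟨h'⟩⟩ | ⟨⟨b', n'⟩, ⟨h'⟩⟩) | h') heq
      · obtain ⟨rfl, rfl⟩ := hσ (hindex heq)
        obtain rfl := (σ a b).injective (Subtype.ext (hindex heq))
        rfl
      · exact ((τ b' n').2.2 ⟨_, heq⟩).elim
      · exact (hσ₀ n (hindex heq)).elim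
      · exact ((τ b n).2.2 ⟨_, heq.symm⟩).elim
      · have h1 := (τ b n).2.1
        rw [show (τ b n).1 = (τ b' n').1 from heq, (τ b' n').2.1] at h1
        obtain rfl : b' = b := Subtype.ext (WithTop.coe_injective h1)
        obtain rfl := (τ b').injective (Subtype.ext heq)
        rfl
      · exact ((τ b n).2.2 ⟨_, heq.symm⟩).elim
      · exact (hσ₀ n' (hindex heq.symm)).elim
      · exact ((τ b' n').2.2 ⟨_, heq⟩).elim
      · exact congrArg Sum.inr (Subsingleton.elim h h')
    · intro k
      by_cases hk : k ∈ Set.range P.index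
      · obtain ⟨i, rfl⟩ := hk
        obtain ⟨x, rfl⟩ := hφ.surjective i
        exact ⟨Q.index x, (hcomm x).symm⟩
      · obtain ⟨b, hb⟩ := P.cod.exists_death_eq (i := k) fun h => hk ⟨i₀, ((hcod k).1 h).symm⟩
        refine ⟨Sum.inl (Sum.inr ⟨⟨b, (τ b).symm ⟨k, hb, hk⟩⟩, ⟨le_rfl, b.2⟩⟩), ?_⟩
        simp [ψ]
  have hIco : ∀ b : Set.Ioi (0 : ℝ), GeneratedAtZero (kappa b) := fun b =>
    GeneratedAtZero.interval ⟨le_rfl, b.2⟩ fun t ht => ht.1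
  have hIci : GeneratedAtZero kappaInfty :=
    GeneratedAtZero.interval (Set.mem_Ici.2 le_rfl) fun t ht => ht
  exact P.nonempty_iso Q hF hF'
    (((GeneratedAtZero.directSum fun _ => hIco _).prod
      (GeneratedAtZero.directSum fun _ => GeneratedAtZero.zero)).prod hIci)
    (((GeneratedAtZero.directSum fun _ => hIco _).prod
      (GeneratedAtZero.directSum fun _ => hIco _)).prod hIci)
    (Equiv.ofBijective φ hφ) (Equiv.ofBijective ψ hψ) hφdeath hψdeath hcomm

end AdaptedPair

end PersistenceModule

/-! ### The induced morphism of an injective map -/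

/-- The class at time `0` of `κ_a → 0` would be killed by the map at time `0`. -/
theorem Ladder.isEmpty_iso_prod_kappaZero {F : Ladder.{u, v}}
    (hF : Function.Injective (F.hom.app 0)) (a : Set.Ioi (0 : ℝ)) (G : Ladder.{u', v'}) :
    IsEmpty (Ladder.Iso F (Ladder.prod (Ladder.kappaZero a) G)) := by
  refine ⟨fun E => ?_⟩
  let y : PersistenceModule.intervalSpace (Set.Ico 0 a.1) 0 :=
    ⟨1, fun h => (h ⟨le_rfl, a.2⟩).elim⟩
  obtain ⟨x, hx⟩ := (E.domIso.app 0).surjective (y, 0)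
  have h1 := E.comm 0 x
  rw [hx] at h1
  have h2 : (Ladder.prod (Ladder.kappaZero a) G).hom.app 0 (y, 0) = 0 :=
    Prod.ext rfl (map_zero (G.hom.app 0))
  rw [h2, LinearEquiv.map_eq_zero_iff, map_eq_zero_iff _ hF] at h1
  rw [h1, map_zero] at hx
  exact zero_ne_one (congrArg (fun p => Subtype.val (Prod.fst p)) hx)

theorem proposition4p3 {X : Type u} {Z : Type v} [MetricSpace X] [Finite X] [Nonempty X]
    [MetricSpace Z] [Finite Z] (g : X → Z) (hg : ∀ x y, dist (g x) (g y) ≤ dist x y)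
    (hinj : Function.Injective g) :
    -- the barcode of the codomain exists
    (∃ m, (VietorisRips.PH0 Z).IsBarcode m) ∧
    -- the sums over all `a > 0` are finite sums
    (∀ b, {a | PersistenceModule.blockFunction (VietorisRips.PH0Map g hg) a b ≠ 0}.Finite) ∧
    -- the decomposition, where `m` is the barcode of the codomain
    (∀ m, (VietorisRips.PH0 Z).IsBarcode m →
      (∀ b, 0 ≤ PersistenceModule.unmatched (VietorisRips.PH0Map g hg) m b) ∧
      Nonempty (Ladder.Iso ⟨VietorisRips.PH0 X, VietorisRips.PH0 Z, VietorisRips.PH0Map g hg⟩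
        (Ladder.prod
          (Ladder.prod
            (Ladder.directSum fun i : (b : Set.Ioi (0 : ℝ)) × (a : {a : Set.Ioi (0 : ℝ) // b ≤ a}) ×
                Fin (PersistenceModule.blockFunction (VietorisRips.PH0Map g hg) a b) =>
              Ladder.kappaKappa i.2.1.2)
            (Ladder.directSum fun i : (b : Set.Ioi (0 : ℝ)) ×
                Fin (PersistenceModule.unmatched (VietorisRips.PH0Map g hg) m b).toNat =>
              Ladder.zeroKappa i.1))
          Ladder.kappaInftyKappaInfty))) ∧
    -- no direct summand is of the form `κ_a → 0`
    (∀ (a : Set.Ioi (0 : ℝ)) (G : Ladder.{u', v'}),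
      IsEmpty (Ladder.Iso ⟨VietorisRips.PH0 X, VietorisRips.PH0 Z, VietorisRips.PH0Map g hg⟩
        (Ladder.prod (Ladder.kappaZero a) G))) := by
  obtain ⟨κ, κ', _, ⟨P⟩⟩ := VietorisRips.exists_adaptedPair hg hinj
  have hf := VietorisRips.PH0Map_zero_injective hg hinj
  have hindex := P.index_injective hf
  have : Finite κ := Finite.of_injective _ hindex
  have : Nonempty Z := Nonempty.map g inferInstance
  have hX := VietorisRips.generatedAtZero_PH0 X
  have hZ := VietorisRips.generatedAtZero_PH0 Z
  have htop := VietorisRips.death_index_eq_top_iff P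
  have hcodtop := VietorisRips.existsUnique_death_eq_top P.cod
  refine ⟨⟨_, P.cod.isBarcode hZ hcodtop⟩, P.finite_support_blockFunction hf, fun m hm => ?_,
    fun a G => Ladder.isEmpty_iso_prod_kappaZero hf a G⟩
  have hN := P.unmatched_eq hf (fun i => (htop i).2) hZ hm
  refine ⟨fun b => by rw [hN]; exact Int.natCast_nonneg _, ?_⟩
  obtain ⟨i₀, hi₀, huniq⟩ := VietorisRips.existsUnique_death_eq_top P.dom
  refine P.nonempty_iso_sum hX hZ hindex i₀ (fun i => ⟨huniq i, fun h => h ▸ hi₀⟩)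
    (fun k => ⟨fun hk => hcodtop.unique hk ((htop i₀).2 hi₀), fun h => h ▸ (htop i₀).2 hi₀⟩)
    (PersistenceModule.blockFunction (VietorisRips.PH0Map g hg)) _ (P.blockFunction_eq hf)
    fun b => ?_
  rw [hN, Int.toNat_natCast]

end
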